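/- Let $p$ be a prime and let $A$ be a $p$-torsion free regular local ring with a finite ring homomorphism $\phi\colon A\to A$ satisfying $\phi(a)\equiv a^p \bmod p$. Let $\omega_A$ be a dualizing module of $A$ with a fixed isomorphism $\iota\colon A\xrightarrow{\sim}\omega_A$, and let $\phi_*\omega_A\to\omega_A$ be the Grothendieck trace map of $\phi$, i.e. an $A$-linear map $\mathrm{tr}$ for which $w\mapsto(b\mapsto \mathrm{tr}(bw))$ is an isomorphism $\phi_*\omega_A\cong\operatorname{Hom}_A(\phi_*A,\omega_A)$. Let $s_\phi\colon A\to W(A)$ be the ring homomorphism whose $r$-th ghost component is $\phi^r$ for every $r\ge 0$; it makes $W_n(A/p)$ an $A$-algebra. Put $\omega_{A/p^n}=\operatorname{Ext}^1_A(A/p^n,\omega_A)$ and $W_n\omega_{A/p}=\operatorname{Ext}^1_A(W_n(A/p),\omega_A)$, let $\iota_n\colon A/p^n\xrightarrow{\sim}\omega_{A/p^n}$ be the isomorphism induced by $\iota$, and let $u\colon\phi_*A/p^n\to A/p^n$ be the composite of $\phi_*\iota_n$, of the trace map $\phi_*\omega_{A/p^n}\to\omega_{A/p^n}$ of $\phi$,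 and of $\iota_n^{-1}$. For $m\le n$ let $T\colon W_m\omega_{A/p}\to W_n\omega_{A/p}$ be the trace map of (dual to) the restriction $Res\colon W_n(A/p)\to W_m(A/p)$. Let $\varphi_{n-1}\colon W_n(A/p)\to\phi^{n-1}_*A/p^n$, $(a_i)_i\mapsto\sum_i p^i\tilde a_i^{\,p^{n-1-i}}$ (with $\tilde a_i\in A$ any lift of $a_i$), be the ghost component map, and let $\lambda_n\colon\phi^{n-1}_*A/p^n\to W_n\omega_{A/p}$ be $\iota_n$ followed by the trace map $\phi^{n-1}_*\omega_{A/p^n}\to W_n\omega_{A/p}$ of $\varphi_{n-1}$. For $e,n\ge1$ put $(F^e_*W_n(A/p))^*=\operatorname{Hom}_{W_n(A/p)}(F^e_*W_n(A/p),W_n\omega_{A/p})$, an $A$-module via $s_\phi$, and let $$\Psi^e_n\colon \phi^{e+n-1}_*A/p^n\xrightarrow{\phi^e_*\lambda_n}\phi^e_*W_n\omega_{A/p}\xrightarrow{\ \sim\ }(F^e_*W_n(A/p))^*,$$ where the second map sends $w$ to $\alpha\mapsto T_{F^e}(\alpha w)$ and $T_{F^e}\colon F^e_*W_n\omega_{A/p}\to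 W_n\omega_{A/p}$ is the trace map of $F^e$. Theorem. $\Psi^e_n$ is an $A$-module homomorphism for all $e,n\ge1$, and the following hold. 1. For $n\ge2$, $e\ge1$ and $g\in A/p^n$: $\Psi^e_n(pg)=T\circ\Psi^e_{n-1}(u(g))\circ Res$, where $u(g)$ is taken modulo $p^{n-1}$. 2. For $n\ge2$ and $e\ge1$ the following diagram commutes and has exact rows: $$\begin{array}{ccccccccc} 0&\to& F^{e+n-1}_*A/p&\xrightarrow{\ \cdot p^{n-1}\ }&\phi^{e+n-1}_*A/p^n&\to&\phi^{e+n-1}_*A/p^{n-1}&\to&0\\ &&\downarrow{\scriptstyle\Psi^e_1\circ u^{n-1}}&&\downarrow{\scriptstyle\Psi^e_n}&&\downarrow{\scriptstyle\Psi^{e+1}_{n-1}}&&\\ 0&\to&(F^e_*A/p)^*&\xrightarrow{(F^e_*Res)^*}&(F^e_*W_n(A/p))^*&\xrightarrow{(F^e_*V)^*}&(F^{e+1}_*W_{n-1}(A/p))^*&\to&0. \end{array}$$ Here $(F^e_*Res)^*$ is $\psi\mapsto T\circ\psi\circ Res$ (for $Res\colon W_n(A/p)\to A/p$), and $(F^e_*V)^*$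 is the unique $A$-linear map such that $T\circ(F^e_*V)^*(\psi)=\psi\circ V$ for all $\psi$; its existence and uniqueness are part of the assertion. In particular, $\Psi^e_n$ is surjective for all $e,n\ge1$. 3. For $n,e\ge1$ and $g\in A/p^n$: $\Psi^e_n(g)=0$ if and only if $u^{r-1}(g)\in(p^r)$ in $A/p^n$ for all $1\le r\le n$. 4. For $n,e\ge1$ and $f,g\in A/p^n$: $\Psi^e_n(g f^{p^{e+n-1}})=[f]\,\Psi^e_n(g)$, where $[f]\in W_n(A/p)$ is the Teichmüller lift of $f \bmod p$. -/

import Mathlib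

open CategoryTheory CategoryTheory.Abelian

universe u

namespace WittDual

set_option linter.unusedSectionVars false

/-- The standing data: a `p`-torsion free ring `A` with a finite lift of Frobenius `φ`, a dualizing
module `ω` of `A` with a fixed isomorphism `ι : A ≅ ω`, and the Grothendieck trace map
`tr : φ_* ω → ω` of `φ`. The last field says that `w ↦ (b ↦ tr (b w))` is a bijection
`φ_* ω ≅ Hom_A(φ_* A, ω)`, which is what makes `tr` the trace map for the
identification `φ^! ω ≅ ω`. -/
structure DualizingData (p : ℕ) (A : Type u) [CommRing A] where
  torsionFree : ∀ a : A, (p : A) * a = 0 → a = 0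
  φ : A →+* A
  lift : ∀ a : A, (p : A) ∣ φ a - a ^ p
  finite : φ.Finite
  ω : ModuleCat.{u} A
  ι : A ≃ₗ[A] ω
  tr : (ModuleCat.restrictScalars φ).obj ω ⟶ ω
  tr_perfect : ∀ h : (ModuleCat.restrictScalars φ).obj (ModuleCat.of A A) ⟶ ω,
    ∃! w : ω, ∀ b : A, h.hom b = tr.hom (b • w : ω)

/-- `A / p^n`. -/
abbrev Ap (p : ℕ) (A : Type u) [CommRing A] (n : ℕ) : Type u := A ⧸ Ideal.span {(p : A) ^ n}

/-- `W_n(A/p)`, the `p`-typical Witt vectors of length `n`. -/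
abbrev W (p : ℕ) (A : Type u) [CommRing A] (n : ℕ) : Type u :=
  TruncatedWittVector p n (A ⧸ Ideal.span {(p : A)})

section Witt

variable (p : ℕ) [hp : Fact p.Prime] (A : Type u) [CommRing A]

/-- The natural surjection `W(A) → W_n(A/p)`. -/
noncomputable def proj (n : ℕ) : WittVector p A →+* W p A n :=
  (WittVector.truncate n).comp (WittVector.map (Ideal.Quotient.mk (Ideal.span {(p : A)})))

variable {p A}

theorem coeff_proj (n : ℕ) (y : WittVector p A) (i : Fin n) :
    (proj p A n y).coeff i = Ideal.Quotient.mk _ (y.coeff i) := by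
  simp [proj, WittVector.coeff_truncate, WittVector.map_coeff]

theorem proj_surjective (n : ℕ) : Function.Surjective (proj p A n) :=
  (WittVector.truncate_surjective p n _).comp
    (WittVector.map_surjective _ Ideal.Quotient.mk_surjective)

theorem ghost_eq (n : ℕ) (y : WittVector p A) :
    WittVector.ghostComponent n y
      = ∑ i ∈ Finset.range (n + 1), (p : A) ^ i * y.coeff i ^ p ^ (n - i) := by
  rw [WittVector.ghostComponent_apply, aeval_wittPolynomial]

theorem ghost_ext (htf : ∀ a : A, (p : A) * a = 0 → a = 0) {x y : WittVector p A}
    (h : ∀ n, WittVector.ghostComponent n x = WittVector.ghostComponent n y) : x = y := by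
  have htf' : ∀ n (a : A), (p : A) ^ n * a = 0 → a = 0 := by
    intro n
    induction n with
    | zero => intro a; simp
    | succ k ih =>
      intro a ha
      exact ih _ (htf _ (by rw [← ha]; ring))
  ext n
  induction n using Nat.strong_induction_on with
  | _ n ih =>
    have h1 := h n
    rw [ghost_eq, ghost_eq, Finset.sum_range_succ, Finset.sum_range_succ] at h1
    have h2 : ∑ i ∈ Finset.range n, (p : A) ^ i * x.coeff i ^ p ^ (n - i)
        = ∑ i ∈ Finset.range n, (p : A) ^ i * y.coeff i ^ p ^ (n - i) :=
      Finset.sum_congr rfl fun i hi => by rw [ih i (Finset.mem_range.1 hi)]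
    rw [h2] at h1
    have h3 := add_left_cancel h1
    simp only [Nat.sub_self, pow_zero, pow_one] at h3
    exact sub_eq_zero.1 (htf' n _ (by rw [mul_sub, h3, sub_self]))

/-- The Frobenius `F` of `W_n(A/p)`, which raises every Witt component to the power `p`. -/
def frobFun (n : ℕ) (x : W p A n) : W p A n := TruncatedWittVector.mk p fun i => x.coeff i ^ p

/-- The shift map `V : W_n(A/p) → W_{n+1}(A/p)`, `(a₀, …, a_{n-1}) ↦ (0, a₀, …, a_{n-1})`. -/
def verFun (n : ℕ) (x : W p A n) : W p A (n + 1) :=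
  TruncatedWittVector.mk p (Fin.cons 0 fun i => x.coeff i)

/-- The ghost component `φ_{n-1} : W_n(A/p) → A/p^n`,
`(a_i) ↦ ∑ p^i ã_i^{p^{n-1-i}}` for lifts `ã_i ∈ A` of `a_i`. -/
noncomputable def ghostFun (n : ℕ) (x : W p A n) : Ap p A n :=
  Ideal.Quotient.mk _ (∑ i : Fin n, (p : A) ^ (i : ℕ) * (x.coeff i).out ^ p ^ (n - 1 - (i : ℕ)))

theorem coeff_ver_proj (n : ℕ) (y : WittVector p A) :
    verFun n (proj p A n y) = proj p A (n + 1) (WittVector.verschiebung y) := by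
  apply TruncatedWittVector.ext
  intro i
  rw [coeff_proj, verFun, TruncatedWittVector.coeff_mk]
  refine Fin.cases ?_ (fun j => ?_) i
  · simp [WittVector.verschiebung_coeff_zero]
  · simp [WittVector.verschiebung_coeff_succ, coeff_proj]

/-- `V` as an additive map. -/
def ver (n : ℕ) : W p A n →+ W p A (n + 1) where
  toFun := verFun n
  map_zero' := by
    have := coeff_ver_proj (p := p) n (0 : WittVector p A)
    simpa using this
  map_add' x y := by
    obtain ⟨x, rfl⟩ := proj_surjective n x
    obtain ⟨y, rfl⟩ := proj_surjective n y
    rw [← map_add, coeff_ver_proj, coeff_ver_proj, coeff_ver_proj, map_add, map_add]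

theorem ghostFun_proj (n : ℕ) (y : WittVector p A) :
    ghostFun n (proj p A n y) = Ideal.Quotient.mk _ (WittVector.ghostComponent (n - 1) y) := by
  rcases n with _ | n
  · have : (Ideal.span {(p : A) ^ 0}) = ⊤ := by simp
    have h : Subsingleton (Ap p A 0) := Ideal.Quotient.subsingleton_iff.2 this
    exact Subsingleton.elim _ _
  · rw [ghost_eq, ghostFun, ← Fin.sum_univ_eq_sum_range
      (fun i => (p : A) ^ i * y.coeff i ^ p ^ (n + 1 - 1 - i)), map_sum, map_sum]
    refine Finset.sum_congr rfl fun i _ => ?_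
    rw [Ideal.Quotient.eq, Ideal.mem_span_singleton, ← mul_sub]
    have h1 : (p : A) ∣ ((proj p A (n + 1) y).coeff i).out - y.coeff i := by
      rw [← Ideal.mem_span_singleton, ← Ideal.Quotient.eq, coeff_proj]
      exact Quotient.out_eq _
    have h2 := dvd_sub_pow_of_dvd_sub h1 (n - i)
    have h3 : (p : A) ^ (n + 1) = (p : A) ^ (i : ℕ) * (p : A) ^ (n - i + 1) := by
      rw [← pow_add]; congr 1; omega
    rw [h3]
    exact mul_dvd_mul_left _ h2

/-- `φ_{n-1} : W_n(A/p) → A/p^n` as a ring homomorphism. -/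
noncomputable def ghost (n : ℕ) : W p A n →+* Ap p A n where
  toFun := ghostFun n
  map_zero' := by
    have := ghostFun_proj (p := p) n (0 : WittVector p A)
    simpa using this
  map_one' := by
    have := ghostFun_proj (p := p) n (1 : WittVector p A)
    simpa using this
  map_add' x y := by
    obtain ⟨x, rfl⟩ := proj_surjective n x
    obtain ⟨y, rfl⟩ := proj_surjective n y
    rw [← map_add, ghostFun_proj, ghostFun_proj, ghostFun_proj, map_add, map_add]
  map_mul' x y := by
    obtain ⟨x, rfl⟩ := proj_surjective n x
    obtain ⟨y, rfl⟩ := proj_surjective n y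
    rw [← map_mul, ghostFun_proj, ghostFun_proj, ghostFun_proj, map_mul, map_mul]

/-- The restriction map `Res : W_n(A/p) → W_m(A/p)` for `m ≤ n`. -/
noncomputable abbrev res {m n : ℕ} (h : m ≤ n) : W p A n →+* W p A m :=
  TruncatedWittVector.truncate h

/-- The Teichmüller lift `[f] ∈ W_n(A/p)` of `f ∈ A/p`. -/
noncomputable def teich (n : ℕ) (f : A ⧸ Ideal.span {(p : A)}) : W p A n :=
  WittVector.truncate n (WittVector.teichmuller p f)

end Witt

namespace DualizingData

variable {p : ℕ} [hp : Fact p.Prime] {A : Type u} [CommRing A] (D : DualizingData p A)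

theorem frobFun_proj (n : ℕ) (y : WittVector p A) :
    frobFun n (proj p A n y) = proj p A n (WittVector.map D.φ y) := by
  apply TruncatedWittVector.ext
  intro i
  rw [coeff_proj, frobFun, TruncatedWittVector.coeff_mk, coeff_proj, WittVector.map_coeff,
    ← map_pow, eq_comm, Ideal.Quotient.eq, Ideal.mem_span_singleton]
  exact D.lift _

/-- The Frobenius `F : W_n(A/p) → W_n(A/p)` as a ring homomorphism. -/
def F (n : ℕ) : W p A n →+* W p A n where
  toFun := frobFun n
  map_zero' := by
    have := D.frobFun_proj n 0
    simpa using this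
  map_one' := by
    have := D.frobFun_proj n 1
    simpa using this
  map_add' x y := by
    obtain ⟨x, rfl⟩ := proj_surjective n x
    obtain ⟨y, rfl⟩ := proj_surjective n y
    rw [← map_add, D.frobFun_proj, D.frobFun_proj, D.frobFun_proj, map_add, map_add]
  map_mul' x y := by
    obtain ⟨x, rfl⟩ := proj_surjective n x
    obtain ⟨y, rfl⟩ := proj_surjective n y
    rw [← map_mul, D.frobFun_proj, D.frobFun_proj, D.frobFun_proj, map_mul, map_mul]

theorem dvd_phi_pow (a : A) (k : ℕ) : (p : A) ^ (k + 1) ∣ D.φ a ^ p ^ k - a ^ p ^ (k + 1) := by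
  have := dvd_sub_pow_of_dvd_sub (D.lift a) k
  rwa [← pow_mul, ← pow_succ'] at this

/-- The components of `s_φ(a)`, determined recursively by
`∑_{i ≤ n} p^i c_i^{p^{n-i}} = φ^n(a)`. -/
noncomputable def sCoeff (a : A) (n : ℕ) : A :=
  Classical.epsilon fun b : A =>
    (p : A) ^ n * b = (D.φ ^ n) a - ∑ i : Fin n, (p : A) ^ (i : ℕ) * sCoeff a i ^ p ^ (n - (i : ℕ))
termination_by n
decreasing_by exact i.2

theorem sCoeff_spec (a : A) (n : ℕ) :
    ∑ i ∈ Finset.range (n + 1), (p : A) ^ i * D.sCoeff a i ^ p ^ (n - i) = (D.φ ^ n) a := by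
  induction n with
  | zero =>
    have h : ∃ b : A, (p : A) ^ 0 * b = (D.φ ^ 0) a
        - ∑ i : Fin 0, (p : A) ^ (i : ℕ) * D.sCoeff a i ^ p ^ (0 - (i : ℕ)) := ⟨a, by simp⟩
    have h2 := Classical.epsilon_spec h
    rw [← sCoeff] at h2
    simpa using h2
  | succ n ih =>
    have h : ∃ b : A, (p : A) ^ (n + 1) * b = (D.φ ^ (n + 1)) a
        - ∑ i : Fin (n + 1), (p : A) ^ (i : ℕ) * D.sCoeff a i ^ p ^ (n + 1 - (i : ℕ)) := by
      suffices (p : A) ^ (n + 1) ∣ (D.φ ^ (n + 1)) a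
          - ∑ i : Fin (n + 1), (p : A) ^ (i : ℕ) * D.sCoeff a i ^ p ^ (n + 1 - (i : ℕ)) by
        obtain ⟨b, hb⟩ := this
        exact ⟨b, hb.symm⟩
      have e1 : (D.φ ^ (n + 1)) a = D.φ ((D.φ ^ n) a) := by rw [pow_succ']; rfl
      rw [e1, ← ih, map_sum, Fin.sum_univ_eq_sum_range
        (fun i => (p : A) ^ i * D.sCoeff a i ^ p ^ (n + 1 - i)), ← Finset.sum_sub_distrib]
      refine Finset.dvd_sum fun i hi => ?_
      have hi' : i ≤ n := Nat.lt_succ_iff.1 (Finset.mem_range.1 hi)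
      rw [map_mul, map_pow, map_natCast, map_pow, ← mul_sub]
      have h3 : (p : A) ^ (n + 1) = (p : A) ^ i * (p : A) ^ (n - i + 1) := by
        rw [← pow_add]; congr 1; omega
      have h4 : n + 1 - i = n - i + 1 := by omega
      rw [h3, h4]
      exact mul_dvd_mul_left _ (D.dvd_phi_pow _ _)
    have h2 := Classical.epsilon_spec h
    rw [← sCoeff] at h2
    rw [Finset.sum_range_succ, ← Fin.sum_univ_eq_sum_range
      (fun i => (p : A) ^ i * D.sCoeff a i ^ p ^ (n + 1 - i)), Nat.sub_self, pow_zero, pow_one, h2]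
    ring

theorem ghost_sCoeff (a : A) (n : ℕ) :
    WittVector.ghostComponent n (WittVector.mk p (D.sCoeff a)) = (D.φ ^ n) a := by
  rw [ghost_eq]
  exact D.sCoeff_spec a n

/-- The ring homomorphism `s_φ : A → W(A)` attached to the lift of Frobenius `φ`, characterised by
`φ_n (s_φ a) = φ^n a` for all ghost components `φ_n`. -/
noncomputable def s : A →+* WittVector p A where
  toFun a := WittVector.mk p (D.sCoeff a)
  map_zero' := ghost_ext D.torsionFree fun n => by rw [ghost_sCoeff]; simp
  map_one' := ghost_ext D.torsionFree fun n => by rw [ghost_sCoeff]; simp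
  map_add' x y := ghost_ext D.torsionFree fun n => by
    rw [map_add, ghost_sCoeff, ghost_sCoeff, ghost_sCoeff, map_add]
  map_mul' x y := ghost_ext D.torsionFree fun n => by
    rw [map_mul, ghost_sCoeff, ghost_sCoeff, ghost_sCoeff, map_mul]

theorem ghost_s (a : A) (n : ℕ) : WittVector.ghostComponent n (D.s a) = (D.φ ^ n) a :=
  D.ghost_sCoeff a n

/-- `s_φ` followed by `W(A) → W_n(A/p)`; it makes `W_n(A/p)` an `A`-algebra. -/
noncomputable def sW (n : ℕ) : A →+* W p A n := (proj p A n).comp D.s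

theorem res_sW {m n : ℕ} (h : m ≤ n) (a : A) : res h (D.sW n a) = D.sW m a :=
  TruncatedWittVector.truncate_wittVector_truncate h
    (WittVector.map (Ideal.Quotient.mk (Ideal.span {(p : A)})) (D.s a))

theorem F_sW (n : ℕ) (a : A) : D.F n (D.sW n a) = D.sW n (D.φ a) := by
  have h1 : WittVector.map D.φ (D.s a) = D.s (D.φ a) := by
    refine ghost_ext D.torsionFree fun k => ?_
    have h2 : WittVector.ghostComponent k (WittVector.map D.φ (D.s a))
        = D.φ (WittVector.ghostComponent k (D.s a)) := by
      simp only [ghost_eq, map_sum, map_mul, map_pow, map_natCast, WittVector.map_coeff]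
    rw [h2, ghost_s, ghost_s]
    have : (D.φ ^ (k + 1)) a = (D.φ ^ (k + 1)) a := rfl
    conv_lhs at this => rw [pow_succ']
    conv_rhs at this => rw [pow_succ]
    exact this
  change frobFun n (proj p A n (D.s a)) = proj p A n (D.s (D.φ a))
  rw [D.frobFun_proj, h1]

theorem ghost_sW (n : ℕ) (a : A) :
    ghost n (D.sW n a) = Ideal.Quotient.mk _ ((D.φ ^ (n - 1)) a) := by
  change ghostFun n (proj p A n (D.s a)) = _
  rw [ghostFun_proj, ghost_s]

/-- `W_n(A/p)` as an `A`-module via `s_φ`. -/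
noncomputable abbrev WMod (n : ℕ) : ModuleCat.{u} A :=
  (ModuleCat.restrictScalars (D.sW n)).obj (ModuleCat.of (W p A n) (W p A n))

/-- The functor `φ^k_*`: restriction of scalars along `φ^k`. -/
noncomputable abbrev push (k : ℕ) : ModuleCat.{u} A ⥤ ModuleCat.{u} A :=
  ModuleCat.restrictScalars (D.φ ^ k)

/-- The trace map `φ_* ω → ω` as a function `ω → ω`. -/
noncomputable def trFun (w : D.ω) : D.ω := D.tr.hom w

theorem trFun_smul (a : A) (w : D.ω) : D.trFun (D.φ a • w) = a • D.trFun w :=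
  D.tr.hom.map_smul a w

theorem trFun_add (v w : D.ω) : D.trFun (v + w) = D.trFun v + D.trFun w :=
  D.tr.hom.map_add v w

theorem trFun_iterate_add (k : ℕ) (v w : D.ω) :
    D.trFun^[k] (v + w) = D.trFun^[k] v + D.trFun^[k] w := by
  induction k generalizing v w with
  | zero => rfl
  | succ k ih => rw [Function.iterate_succ_apply, trFun_add, ih]; rfl

theorem trFun_iterate_smul (k : ℕ) (a : A) (w : D.ω) :
    D.trFun^[k] ((D.φ ^ k) a • w) = a • D.trFun^[k] w := by
  induction k generalizing w with
  | zero => rfl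
  | succ k ih =>
    have e1 : (D.φ ^ (k + 1)) a = D.φ ((D.φ ^ k) a) := by rw [pow_succ']; rfl
    rw [Function.iterate_succ_apply, e1, trFun_smul, ih]; rfl

/-- The `k`-fold iterate `φ^k_* ω → ω` of the trace map. -/
noncomputable def trIter (k : ℕ) : (D.push k).obj D.ω ⟶ D.ω :=
  ModuleCat.ofHom (X := (D.push k).obj D.ω) (Y := D.ω)
  { toFun := D.trFun^[k]
    map_add' := D.trFun_iterate_add k
    map_smul' := D.trFun_iterate_smul k }

/-- The Grothendieck trace map `φ^k_* Ext¹(M, ω) → Ext¹(N, ω)` of an `A`-linear map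
`h : N → φ^k_* M`: the composite
`Ext¹(M, ω) → Ext¹(φ^k_* M, φ^k_* ω) → Ext¹(φ^k_* M, ω) → Ext¹(N, ω)` of the functor `φ^k_*`,
of the trace `φ^k_* ω → ω`, and of the pullback along `h`. -/
noncomputable def trace (k : ℕ) {M N : ModuleCat.{u} A} (h : N ⟶ (D.push k).obj M) :
    Ext.{u} M D.ω 1 →+ Ext.{u} N D.ω 1 where
  toFun x := (Ext.mk₀ h).comp
    ((x.mapExactFunctor (D.push k)).comp (Ext.mk₀ (D.trIter k)) (add_zero 1)) (zero_add 1)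
  map_zero' := by simp [Ext.mapExactFunctor_zero]
  map_add' x y := by simp [Ext.mapExactFunctor_add]

/-! ### `A/p^n` and `ω_{A/p^n}` -/

/-- `A/p^n` as an `A`-module. -/
abbrev ApMod (_ : DualizingData p A) (n : ℕ) : ModuleCat.{u} A := ModuleCat.of A (Ap p A n)

/-- `ω_{A/p^n} = Ext¹_A(A/p^n, ω)`. -/
abbrev ApΩ (n : ℕ) : Type u := Ext.{u} (D.ApMod n) D.ω 1

theorem pow_torsionFree {p : ℕ} {A : Type u} [CommRing A] (D : DualizingData p A) (n : ℕ) (a : A) (h : (p : A) ^ n * a = 0) : a = 0 := by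
  induction n generalizing a with
  | zero => simpa using h
  | succ k ih => exact ih _ (D.torsionFree _ (by rw [← mul_assoc, ← pow_succ', h]))

/-- The short exact sequence `0 → A → A → A/p^n → 0` whose first map is multiplication by `p^n`. -/
abbrev seq (_ : DualizingData p A) (n : ℕ) : ShortComplex (ModuleCat.{u} A) where
  X₁ := ModuleCat.of A A
  X₂ := ModuleCat.of A A
  X₃ := ModuleCat.of A (Ap p A n)
  f := ModuleCat.ofHom (LinearMap.mulLeft A ((p : A) ^ n))
  g := ModuleCat.ofHom (Submodule.mkQ (Ideal.span {(p : A) ^ n}))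
  zero := by
    ext
    simp

theorem seq_shortExact (n : ℕ) : (D.seq n).ShortExact where
  exact := by
    rw [ShortComplex.ShortExact.moduleCat_exact_iff_function_exact]
    intro (x : A)
    change Ideal.Quotient.mk _ (x : A) = 0 ↔ ∃ y : A, (p : A) ^ n * y = x
    rw [Ideal.Quotient.eq_zero_iff_mem, Ideal.mem_span_singleton]
    exact ⟨fun ⟨y, h⟩ => ⟨y, h.symm⟩, fun ⟨y, h⟩ => ⟨y, h.symm⟩⟩
  mono_f := by
    refine (ModuleCat.mono_iff_injective _).2 fun (x : A) (y : A) h => ?_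
    change (p : A) ^ n * x = (p : A) ^ n * y at h
    exact sub_eq_zero.1 (D.pow_torsionFree n _ (by rw [mul_sub, h, sub_self]))
  epi_g := (ModuleCat.epi_iff_surjective _).2 (Submodule.mkQ_surjective _)

/-- The homomorphism `A → ω` sending `1` to `w`. -/
def homOf (w : D.ω) : ModuleCat.of A A ⟶ D.ω := ModuleCat.ofHom (LinearMap.toSpanSingleton A D.ω w)

theorem homOf_apply (w : D.ω) (b : A) : (D.homOf w).hom b = b • w := rfl

theorem homOf_eq (g : ModuleCat.of A A ⟶ D.ω) : D.homOf (g.hom (1 : A)) = g := by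
  ext
  exact one_smul A _

/-- The map `A → ω_{A/p^n}`: the isomorphism `ι : A ≅ ω = Hom(A, ω)` followed by the connecting
homomorphism `Hom(A, ω) → Ext¹(A/p^n, ω)` of `0 → A → A → A/p^n → 0`. -/
noncomputable def connecting (n : ℕ) : A →ₗ[A] D.ApΩ n where
  toFun a := (D.seq_shortExact n).extClass.comp (Ext.mk₀ (D.homOf (D.ι a))) (add_zero 1)
  map_add' a b := by
    have : D.homOf (D.ι (a + b)) = D.homOf (D.ι a) + D.homOf (D.ι b) := by
      ext
      change (1 : A) • D.ι (a + b) = (1 : A) • D.ι a + (1 : A) • D.ι b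
      rw [map_add, smul_add]
    rw [← Ext.comp_add, ← Ext.mk₀_add, this]
  map_smul' c a := by
    have : D.homOf (D.ι (c • a)) = c • D.homOf (D.ι a) := by
      ext
      change (1 : A) • D.ι (c • a) = c • (1 : A) • D.ι a
      rw [map_smul, one_smul, one_smul]
    rw [RingHom.id_apply, ← Ext.comp_smul, ← Ext.mk₀_smul, this]

theorem connecting_apply (n : ℕ) (a : A) : D.connecting n a =
    (D.seq_shortExact n).extClass.comp (Ext.mk₀ (D.homOf (D.ι a))) (add_zero 1) := rfl

theorem connecting_ker (n : ℕ) : LinearMap.ker (D.connecting n) = Ideal.span {(p : A) ^ n} := by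
  ext a
  rw [LinearMap.mem_ker, connecting_apply]
  refine Iff.trans ?_ Ideal.mem_span_singleton.symm
  constructor
  · intro h
    obtain ⟨x, hx⟩ := Ext.contravariant_sequence_exact₁ (D.seq_shortExact n) D.ω
      (Ext.mk₀ (D.homOf (D.ι a))) (add_zero 1) h
    obtain ⟨g, rfl⟩ := (Ext.mk₀_bijective _ _).2 x
    rw [Ext.mk₀_comp_mk₀] at hx
    have h2 := (Ext.mk₀_bijective _ _).1 hx
    have h4 : g.hom ((p : A) ^ n * 1 : A) = (1 : A) • D.ι a :=
      congrArg (fun k : ModuleCat.of A A ⟶ D.ω => k.hom (1 : A)) h2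
    have h5 : g.hom ((p : A) ^ n * 1 : A) = (p : A) ^ n • (g.hom (1 : A) : D.ω) :=
      g.hom.map_smul ((p : A) ^ n) (1 : A)
    refine ⟨D.ι.symm (g.hom (1 : A)), D.ι.injective ?_⟩
    rw [← smul_eq_mul, map_smul, D.ι.apply_symm_apply, ← h5, h4, one_smul]
  · rintro ⟨b, rfl⟩
    have h1 : D.homOf (D.ι ((p : A) ^ n * b)) = (D.seq n).f ≫ D.homOf (D.ι b) := by
      ext
      change (1 : A) • D.ι ((p : A) ^ n * b) = ((p : A) ^ n * 1) • D.ι b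
      rw [one_smul, mul_one, ← smul_eq_mul, map_smul]
    rw [h1, ← Ext.mk₀_comp_mk₀]
    exact (D.seq_shortExact n).extClass_comp_assoc _

theorem connecting_surjective (n : ℕ) : Function.Surjective (D.connecting n) := by
  intro x
  have : Projective (D.seq n).X₂ := by dsimp [seq]; infer_instance
  obtain ⟨y, hy⟩ := Ext.contravariant_sequence_exact₃ (D.seq_shortExact n) D.ω x
    (Ext.eq_zero_of_projective _) (add_zero 1)
  obtain ⟨g, rfl⟩ := (Ext.mk₀_bijective _ _).2 y
  refine ⟨D.ι.symm (g.hom (1 : A)), ?_⟩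
  rw [connecting_apply, D.ι.apply_symm_apply, homOf_eq, hy]

/-- The isomorphism `ι_n : A/p^n ≅ ω_{A/p^n}` induced by `ι`. -/
noncomputable def iota (n : ℕ) : Ap p A n ≃ₗ[A] D.ApΩ n :=
  (Submodule.quotEquivOfEq _ _ (D.connecting_ker n).symm).trans
    ((D.connecting n).quotKerEquivOfSurjective (D.connecting_surjective n))

theorem iota_mk (n : ℕ) (a : A) : D.iota n (Ideal.Quotient.mk _ a) = D.connecting n a := rfl

/-- The map `A/p^n → φ_* A/p^n` induced by `φ`. -/
noncomputable def phiHom (n : ℕ) : D.ApMod n ⟶ (D.push 1).obj (D.ApMod n) :=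
  ModuleCat.ofHom (X := D.ApMod n) (Y := (D.push 1).obj (D.ApMod n))
  { toFun := Ideal.quotientMap (I := Ideal.span {(p : A) ^ n}) (Ideal.span {(p : A) ^ n}) (D.φ ^ 1) (by
      rw [Ideal.span_singleton_le_iff_mem, Ideal.mem_comap, map_pow, map_natCast]
      exact Ideal.mem_span_singleton_self _)
    map_add' := fun x y => map_add _ x y
    map_smul' := by
      intro a x
      obtain ⟨x, rfl⟩ := Ideal.Quotient.mk_surjective x
      change Ideal.Quotient.mk _ ((D.φ ^ 1) (a * x))
        = Ideal.Quotient.mk _ ((D.φ ^ 1) a) * Ideal.Quotient.mk _ ((D.φ ^ 1) x)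
      rw [map_mul, map_mul] }

/-- `u : φ_* A/p^n → A/p^n`, the composite of `ι_n`, of the trace map
`φ^* : φ_* ω_{A/p^n} → ω_{A/p^n}`, and of `ι_n⁻¹`. -/
noncomputable def u (n : ℕ) (a : Ap p A n) : Ap p A n :=
  (D.iota n).symm (D.trace 1 (D.phiHom n) (D.iota n a))

/-! ### `W_nω_{A/p}` and `λ_n` -/

/-- Multiplication by `α ∈ W_n(A/p)` on `W_n(A/p)`, as an `A`-linear map. -/
noncomputable def mulHom (n : ℕ) (α : W p A n) : D.WMod n ⟶ D.WMod n :=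
  ModuleCat.ofHom (X := D.WMod n) (Y := D.WMod n)
  { toFun := fun x : W p A n => (α * x : W p A n)
    map_add' := fun x y : W p A n => mul_add α x y
    map_smul' := fun (a : A) (x : W p A n) => mul_left_comm α (D.sW n a) x }

/-- `W_nω_{A/p} = Ext¹_A(W_n(A/p), ω)`. -/
abbrev Wω (n : ℕ) : Type u := Ext.{u} (D.WMod n) D.ω 1

/-- `W_n(A/p)` acts on `Ext¹_A(W_n(A/p), ω)` through the first variable. -/
noncomputable instance (n : ℕ) : Module (W p A n) (D.Wω n) where
  smul α x := (Ext.mk₀ (D.mulHom n α)).comp (x : Ext.{u} (D.WMod n) D.ω 1) (zero_add 1)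
  one_smul x := by
    change (Ext.mk₀ (D.mulHom n 1)).comp (x : Ext.{u} (D.WMod n) D.ω 1) (zero_add 1) = x
    have : D.mulHom n 1 = 𝟙 _ := by
      ext (y : W p A n)
      exact one_mul y
    rw [this, Ext.mk₀_id_comp]
  mul_smul α β x := by
    change (Ext.mk₀ (D.mulHom n (α * β))).comp (x : Ext.{u} (D.WMod n) D.ω 1) (zero_add 1)
      = (Ext.mk₀ (D.mulHom n α)).comp ((Ext.mk₀ (D.mulHom n β)).comp x (zero_add 1)) (zero_add 1)
    have : D.mulHom n (α * β) = D.mulHom n α ≫ D.mulHom n β := by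
      ext (y : W p A n)
      change α * β * y = β * (α * y)
      ring
    rw [this, Ext.mk₀_comp_mk₀_assoc]
  smul_zero α := Ext.comp_zero _ _ _ _ _
  smul_add α x y := Ext.comp_add _ _ _ _
  add_smul α β x := by
    change (Ext.mk₀ (D.mulHom n (α + β))).comp (x : Ext.{u} (D.WMod n) D.ω 1) (zero_add 1) = _
    have : D.mulHom n (α + β) = D.mulHom n α + D.mulHom n β := by
      ext (y : W p A n)
      exact add_mul α β y
    rw [this, Ext.mk₀_add, Ext.add_comp]
    rfl
  zero_smul x := by
    change (Ext.mk₀ (D.mulHom n 0)).comp (x : Ext.{u} (D.WMod n) D.ω 1) (zero_add 1) = 0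
    have : D.mulHom n 0 = 0 := by
      ext (y : W p A n)
      exact zero_mul y
    rw [this, Ext.mk₀_zero, Ext.zero_comp]

theorem smul_def (n : ℕ) (α : W p A n) (x : D.Wω n) :
    α • x = (Ext.mk₀ (D.mulHom n α)).comp (x : Ext.{u} (D.WMod n) D.ω 1) (zero_add 1) := rfl

/-- `Res : W_n(A/p) → W_m(A/p)` as an `A`-linear map. -/
noncomputable def resHom {m n : ℕ} (h : m ≤ n) : D.WMod n ⟶ D.WMod m :=
  ModuleCat.ofHom (X := D.WMod n) (Y := D.WMod m)
  { toFun := fun x : W p A n => (res h x : W p A m)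
    map_add' := fun x y : W p A n => map_add (res h) x y
    map_smul' := fun (a : A) (x : W p A n) => by
      change res h (D.sW n a * x) = D.sW m a * res h x
      rw [map_mul, res_sW] }

/-- The Grothendieck trace map `T : W_mω_{A/p} → W_nω_{A/p}` for `m ≤ n`, the dual of
`Res : W_n(A/p) → W_m(A/p)`. -/
noncomputable def T {m n : ℕ} (h : m ≤ n) : D.Wω m →+ D.Wω n where
  toFun x := (Ext.mk₀ (D.resHom h)).comp (x : Ext.{u} (D.WMod m) D.ω 1) (zero_add 1)
  map_zero' := Ext.comp_zero _ _ _ _ _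
  map_add' _ _ := Ext.comp_add _ _ _ _

theorem T_smul {m n : ℕ} (h : m ≤ n) (α : W p A n) (x : D.Wω m) :
    D.T h (res h α • x) = α • D.T h x := by
  have h1 : D.resHom h ≫ D.mulHom m (res h α) = D.mulHom n α ≫ D.resHom h := by
    ext (y : W p A n)
    exact (map_mul (res h) α y).symm
  change (Ext.mk₀ (D.resHom h)).comp ((Ext.mk₀ (D.mulHom m (res h α))).comp x (zero_add 1))
      (zero_add 1)
    = (Ext.mk₀ (D.mulHom n α)).comp ((Ext.mk₀ (D.resHom h)).comp x (zero_add 1)) (zero_add 1)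
  rw [Ext.mk₀_comp_mk₀_assoc, Ext.mk₀_comp_mk₀_assoc, h1]

/-- `φ_{n-1} : W_n(A/p) → φ^{n-1}_* A/p^n` as an `A`-linear map. -/
noncomputable def ghostHom (n : ℕ) : D.WMod n ⟶ (D.push (n - 1)).obj (D.ApMod n) :=
  ModuleCat.ofHom (X := D.WMod n) (Y := (D.push (n - 1)).obj (D.ApMod n))
  { toFun := fun x : W p A n => (ghost n x : Ap p A n)
    map_add' := fun x y : W p A n => map_add (ghost n) x y
    map_smul' := fun (a : A) (x : W p A n) => by
      change ghost n (D.sW n a * x) = Ideal.Quotient.mk _ ((D.φ ^ (n - 1)) a) * ghost n x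
      rw [map_mul, ghost_sW] }

/-- `λ_n : φ^{n-1}_* A/p^n → W_nω_{A/p}`, the composite of `ι_n` and of the trace map
`φ^{n-1}_* ω_{A/p^n} → W_nω_{A/p}` of `φ_{n-1}`. -/
noncomputable def lam (n : ℕ) : Ap p A n →+ D.Wω n :=
  (D.trace (n - 1) (D.ghostHom n)).comp (D.iota n).toAddMonoidHom

/-! ### The duals `Hom(F^e_* W_n(A/p), W_nω_{A/p})` and `Ψ^e_n` -/

theorem F_pow_sW (n e : ℕ) (a : A) : (D.F n ^ e) (D.sW n a) = D.sW n ((D.φ ^ e) a) := by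
  induction e generalizing a with
  | zero => rfl
  | succ k ih =>
    rw [pow_succ, pow_succ]
    change (D.F n ^ k) (D.F n (D.sW n a)) = D.sW n ((D.φ ^ k) (D.φ a))
    rw [F_sW, ih]

/-- `F^e : W_n(A/p) → φ^e_* W_n(A/p)` as an `A`-linear map. -/
noncomputable def FHom (n e : ℕ) : D.WMod n ⟶ (D.push e).obj (D.WMod n) :=
  ModuleCat.ofHom (X := D.WMod n) (Y := (D.push e).obj (D.WMod n))
  { toFun := fun x : W p A n => ((D.F n ^ e) x : W p A n)
    map_add' := fun x y : W p A n => map_add (D.F n ^ e) x y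
    map_smul' := fun (a : A) (x : W p A n) => by
      change (D.F n ^ e) (D.sW n a * x) = D.sW n ((D.φ ^ e) a) * (D.F n ^ e) x
      rw [map_mul, F_pow_sW] }

/-- The Grothendieck trace map `T_{F^e} : F^e_* W_nω_{A/p} → W_nω_{A/p}`. -/
noncomputable def trF (n e : ℕ) : D.Wω n →+ D.Wω n := D.trace e (D.FHom n e)

theorem trF_smul (n e : ℕ) (β : W p A n) (x : D.Wω n) :
    D.trF n e ((D.F n ^ e) β • x) = β • D.trF n e x := by
  have h1 : D.FHom n e ≫ (D.push e).map (D.mulHom n ((D.F n ^ e) β))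
      = D.mulHom n β ≫ D.FHom n e := by
    ext (y : W p A n)
    exact (map_mul (D.F n ^ e) β y).symm
  change (Ext.mk₀ (D.FHom n e)).comp ((((Ext.mk₀ (D.mulHom n ((D.F n ^ e) β))).comp
      x (zero_add 1)).mapExactFunctor (D.push e)).comp (Ext.mk₀ (D.trIter e)) (add_zero 1))
        (zero_add 1)
    = (Ext.mk₀ (D.mulHom n β)).comp ((Ext.mk₀ (D.FHom n e)).comp
      ((x.mapExactFunctor (D.push e)).comp (Ext.mk₀ (D.trIter e)) (add_zero 1)) (zero_add 1))
        (zero_add 1)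
  rw [Ext.mapExactFunctor_comp, Ext.mapExactFunctor_mk₀, Ext.mk₀_comp_mk₀_assoc,
    Ext.comp_assoc_of_third_deg_zero, Ext.mk₀_comp_mk₀_assoc, h1]

/-- `F^e_* W_n(A/p)`: the module `W_n(A/p)` over itself by restriction of scalars along `F^e`. -/
def FW (_ : DualizingData p A) (_ n : ℕ) : Type u := W p A n

noncomputable instance (e n : ℕ) : AddCommGroup (D.FW e n) :=
  inferInstanceAs (AddCommGroup (W p A n))

noncomputable instance (e n : ℕ) : Module (W p A n) (D.FW e n) :=
  Module.compHom (W p A n) (D.F n ^ e)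

/-- `(F^e_* W_n(A/p))^* = Hom_{W_n(A/p)}(F^e_* W_n(A/p), W_nω_{A/p})`. -/
def Dual (e n : ℕ) : Type u := D.FW e n →ₗ[W p A n] D.Wω n

noncomputable instance (e n : ℕ) : AddCommGroup (D.Dual e n) :=
  inferInstanceAs (AddCommGroup (D.FW e n →ₗ[W p A n] D.Wω n))

noncomputable instance (e n : ℕ) : Module (W p A n) (D.Dual e n) :=
  inferInstanceAs (Module (W p A n) (D.FW e n →ₗ[W p A n] D.Wω n))

/-- The `A`-module structure on the dual, via `s_φ`. -/
noncomputable instance (e n : ℕ) : Module A (D.Dual e n) := Module.compHom _ (D.sW n)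

/-- The value `ψ(F^e_* α)`. -/
def Dual.app {D : DualizingData p A} {e n : ℕ} (ψ : D.Dual e n) (α : W p A n) : D.Wω n :=
  AddHom.toFun (LinearMap.toAddHom ψ) α

theorem Dual.app_add {D : DualizingData p A} {e n : ℕ} (ψ : D.Dual e n) (α β : W p A n) :
    ψ.app (α + β) = ψ.app α + ψ.app β := LinearMap.map_add ψ α β

theorem Dual.app_smul {D : DualizingData p A} {e n : ℕ} (ψ : D.Dual e n) (β α : W p A n) :
    ψ.app ((D.F n ^ e) β * α) = β • ψ.app α := LinearMap.map_smul ψ β α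

/-- An element of the dual from an additive map `h` with `h (F^e(β) α) = β h(α)`. -/
noncomputable def Dual.mk {D : DualizingData p A} {e n : ℕ} (h : W p A n → D.Wω n)
    (h_add : ∀ α β, h (α + β) = h α + h β)
    (h_smul : ∀ β α, h ((D.F n ^ e) β * α) = β • h α) : D.Dual e n :=
  LinearMap.mk (AddHom.mk (M := D.FW e n) h h_add) h_smul

theorem Dual.app_mk {D : DualizingData p A} {e n : ℕ} (h : W p A n → D.Wω n) (h_add h_smul)
    (α : W p A n) : (Dual.mk (D := D) (e := e) h h_add h_smul).app α = h α := rfl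

theorem Dual.add_app {D : DualizingData p A} {e n : ℕ} (ψ χ : D.Dual e n) (α : W p A n) :
    (ψ + χ).app α = ψ.app α + χ.app α := rfl

theorem Dual.smul_app {D : DualizingData p A} {e n : ℕ} (β : W p A n) (ψ : D.Dual e n)
    (α : W p A n) : (β • ψ).app α = β • ψ.app α := rfl

theorem Dual.smul_app' {D : DualizingData p A} {e n : ℕ} (a : A) (ψ : D.Dual e n)
    (α : W p A n) : (a • ψ).app α = D.sW n a • ψ.app α := rfl

theorem Dual.ext {D : DualizingData p A} {e n : ℕ} {ψ χ : D.Dual e n}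
    (h : ∀ α, ψ.app α = χ.app α) : ψ = χ := LinearMap.ext h

/-- `Ψ^e_n : φ^{e+n-1}_* A/p^n → Hom(F^e_* W_n(A/p), W_nω_{A/p})`: the composite of `φ^e_* λ_n` and
of the duality isomorphism `φ^e_* W_nω_{A/p} → Hom(F^e_* W_n(A/p), W_nω_{A/p})`, which
sends `w` to `α ↦ T_{F^e}(α w)`. -/
noncomputable def Psi (e n : ℕ) (g : Ap p A n) : D.Dual e n :=
  Dual.mk (fun α => D.trF n e (α • D.lam n g))
    (fun α β => by rw [add_smul, map_add])
    (fun β α => by rw [mul_smul, trF_smul])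

theorem res_F_pow {m n : ℕ} (h : m ≤ n) (e : ℕ) (x : W p A n) :
    res h ((D.F n ^ e) x) = (D.F m ^ e) (res h x) := by
  induction e generalizing x with
  | zero => rfl
  | succ k ih =>
    rw [pow_succ, pow_succ]
    change res h ((D.F n ^ k) (D.F n x)) = (D.F m ^ k) (D.F m (res h x))
    rw [ih]
    congr 1
    apply TruncatedWittVector.ext
    intro i
    change _ = (frobFun m (res h x)).coeff i
    rw [TruncatedWittVector.coeff_truncate]
    simp only [F, RingHom.coe_mk, MonoidHom.coe_mk, OneHom.coe_mk, frobFun,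
      TruncatedWittVector.coeff_mk, TruncatedWittVector.coeff_truncate]

/-- The dual `(F^e_* Res)^* : (F^e_* W_m(A/p))^* → (F^e_* W_n(A/p))^*` of the restriction map for
`m ≤ n`, which sends `ψ` to `T ∘ ψ ∘ Res`. -/
noncomputable def resDual (e : ℕ) {m n : ℕ} (h : m ≤ n) : D.Dual e m →ₗ[A] D.Dual e n where
  toFun ψ := Dual.mk (fun α => D.T h (ψ.app (res h α)))
    (fun α β => by rw [map_add, Dual.app_add, map_add])
    (fun β α => by rw [map_mul, res_F_pow, Dual.app_smul, T_smul])
  map_add' ψ χ := Dual.ext fun α => by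
    rw [Dual.add_app, Dual.app_mk, Dual.app_mk, Dual.app_mk, Dual.add_app, map_add]
  map_smul' a ψ := Dual.ext fun α => by
    rw [RingHom.id_apply, Dual.smul_app', Dual.app_mk, Dual.app_mk, Dual.smul_app', ← T_smul,
      res_sW]

/-- `Vd` is the dual `(F^e_* V)^* : (F^e_* W_{n+1}(A/p))^* → (F^{e+1}_* W_n(A/p))^*` of the shift map
`V : F^{e+1}_* W_n(A/p) → F^e_* W_{n+1}(A/p)`. A homomorphism `ψ ∘ V` with values in
`W_{n+1}ω_{A/p}` is regarded as one with values in `W_nω_{A/p}` by means of the trace map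
`T : W_nω_{A/p} → W_{n+1}ω_{A/p}`, that is, `T ∘ Vd ψ = ψ ∘ V`. -/
def IsVerDual (e n : ℕ) (Vd : D.Dual e (n + 1) →ₗ[A] D.Dual (e + 1) n) : Prop :=
  ∀ (ψ : D.Dual e (n + 1)) (α : W p A n), D.T n.le_succ ((Vd ψ).app α) = ψ.app (ver n α)

end DualizingData

section Quotients

variable (p : ℕ) (A : Type u) [CommRing A]

/-- Multiplication by `p^n`, as a map `A/p → A/p^{n+1}`. -/
def mulPow (n : ℕ) : Ap p A 1 →ₗ[A] Ap p A (n + 1) :=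
  Submodule.mapQ (Ideal.span {(p : A) ^ 1}) (Ideal.span {(p : A) ^ (n + 1)})
    (LinearMap.mulLeft A ((p : A) ^ n)) (by
      intro x hx
      obtain ⟨y, rfl⟩ := Ideal.mem_span_singleton.1 hx
      refine Ideal.mem_span_singleton.2 ⟨y, ?_⟩
      change (p : A) ^ n * ((p : A) ^ 1 * y) = (p : A) ^ (n + 1) * y
      ring)

/-- The natural surjection `A/p^n → A/p^m` for `m ≤ n`. -/
def red {m n : ℕ} (h : m ≤ n) : Ap p A n →+* Ap p A m :=
  Ideal.Quotient.factor (Ideal.span_singleton_le_span_singleton.2 (pow_dvd_pow _ h))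

/-- The natural surjection `A/p^n → A/p` for `n ≥ 1`. -/
def redP {n : ℕ} (h : 1 ≤ n) : Ap p A n →+* A ⧸ Ideal.span {(p : A)} :=
  Ideal.Quotient.factor (Ideal.span_singleton_le_span_singleton.2
    (dvd_pow_self _ (Nat.one_le_iff_ne_zero.1 h)))

end Quotients

end WittDual

/-! For `M` killed by a power of `p`, the sequence `0 → ω → A[1/p] → A[1/p]/A → 0` (with `ω`
identified with `A` through `ι`) identifies `Ext¹(M, ω)` with `Hom(M, A[1/p]/A)`, because `p` acts
invertibly on `A[1/p]` and nilpotently on `M`. Under this identification (`delta`, `ev`) every trace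
map is precomposition with the given map of modules, followed by an iterate of the additive map `trA
: A → A`, extended to `A[1/p]/A`. The map `u` becomes `trA` mod `p^n`, and `Ψ` becomes the explicit
pairing (`ev_Psi_mk`) `Ψ^e_n(g)(α)(x) = trA^{e+n-1}(g · w_{n-1}(y)) / p^n` in `A[1/p]/A`, where `y ∈
W(A)` lifts `α · F^e(x)` and `w_{n-1}` is the ghost component.

The formal assertions are read off from this formula. Linearity and (4) use `trA(φ(a)b) = a trA(b)`
and `w_{n-1}([f]) = f^{p^{n-1}}`. The compatibilities with `Res` use the Dwork congruence `w_{n+1} ≡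
φ(w_n) mod p^{n+1}`, the one with `V` uses `w_{n+1}(V y) = p w_n(y)`. The lower row is exact because
the kernel of `Res : W_{n+1} → W_1` is the image of `V`, together with the projection formula `V(y)
x = V(y F(Res x))`.

Surjectivity follows by induction on `n` from the diagram, once it is known for `n = 1` and once
`trA` is surjective mod `p`. Both rest on the freeness of `φ_* A`: the lift of Frobenius forces `p ∉
m²`, so `m` is generated by a regular sequence `p, x_2, …, x_d`; as `φ(x_i) ≡ x_i^p mod p`, this
sequence is also regular on `φ_* A`. When `p` is a unit, `A/p = 0` and there is nothing to prove.

The kernel (3) is found by induction on `n`: testing against `V^{n-1}[b]`, of ghost component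
`p^{n-1} b`, perfectness of the trace shows `p ∣ g`; writing `g = p g'`, the Dwork congruence
reduces the claim to `trA(g')` at level `n - 1`. -/

namespace WittDual

set_option linter.unusedSectionVars false

/-! ### The modules `A[1/p]` and `A[1/p]/A`. -/

section Loc

variable (p : ℕ) (A : Type u) [CommRing A]

/-- The ring `A[1/p]`. -/
abbrev Loc : Type u := Localization.Away (p : A)

/-- The `A`-module `A[1/p]/A`. -/
abbrev LocQuot : Type u := Loc p A ⧸ LinearMap.range (Algebra.linearMap A (Loc p A))

theorem isUnit_natCast_loc : IsUnit (p : Loc p A) := by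
  have := IsLocalization.Away.algebraMap_isUnit (S := Loc p A) (p : A)
  rwa [map_natCast] at this

/-- The element `1/p` of `A[1/p]`. -/
noncomputable def locInv : Loc p A := ((isUnit_natCast_loc p A).unit⁻¹ : (Loc p A)ˣ)

theorem natCast_mul_locInv : (p : Loc p A) * locInv p A = 1 :=
  (isUnit_natCast_loc p A).mul_val_inv

theorem pow_mul_locInv_pow (n : ℕ) : (p : Loc p A) ^ n * locInv p A ^ n = 1 := by
  rw [← mul_pow, natCast_mul_locInv, one_pow]

variable {p A}

theorem exists_eq_mul_locInv_pow (x : Loc p A) :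
    ∃ (n : ℕ) (a : A), x = algebraMap A (Loc p A) a * locInv p A ^ n := by
  obtain ⟨⟨a, ⟨_, n, rfl⟩⟩, h⟩ := IsLocalization.surj (Submonoid.powers (p : A)) x
  refine ⟨n, a, ?_⟩
  rw [← h, mul_assoc]
  simp [pow_mul_locInv_pow]

theorem pow_mul_loc_cancel (n : ℕ) {x y : Loc p A}
    (h : (p : Loc p A) ^ n * x = (p : Loc p A) ^ n * y) :
    x = y :=
  ((isUnit_natCast_loc p A).pow n).mul_left_cancel h

theorem exists_pow_mul_eq_zero (a : A) (ha : algebraMap A (Loc p A) a = 0) :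
    ∃ n : ℕ, (p : A) ^ n * a = 0 := by
  obtain ⟨⟨_, n, rfl⟩, h⟩ := (IsLocalization.map_eq_zero_iff (Submonoid.powers (p : A)) _ a).1 ha
  exact ⟨n, h⟩

variable (p A) in
/-- The inclusion `A → A[1/p]` as a map of abelian groups. -/
noncomputable def toLoc : A →ₗ[ℤ] Loc p A :=
  (algebraMap A (Loc p A)).toAddMonoidHom.toIntLinearMap

/-- The trace is additive but only `φ⁻¹`-linear over `A`. Localizing over `ℤ` lets any additive
endomorphism of `A` extend to `A[1/p]`. -/
instance : IsLocalizedModule (Submonoid.powers (p : ℤ)) (toLoc p A) where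
  map_units := by
    rintro ⟨_, n, rfl⟩
    rw [Module.End.isUnit_iff]
    have h (x : Loc p A) : algebraMap ℤ (Module.End ℤ (Loc p A)) ((p : ℤ) ^ n) x
        = (p : Loc p A) ^ n * x := by
      rw [Module.algebraMap_end_apply, zsmul_eq_mul, Int.cast_pow, Int.cast_natCast]
    refine ⟨fun x y hxy => pow_mul_loc_cancel n ?_, fun x => ⟨locInv p A ^ n * x, ?_⟩⟩
    · rw [← h, ← h]
      exact hxy
    · refine (h _).trans ?_
      rw [← mul_assoc, pow_mul_locInv_pow, one_mul]
  surj x := by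
    obtain ⟨n, a, rfl⟩ := exists_eq_mul_locInv_pow x
    refine ⟨(a, ⟨_, n, rfl⟩), ?_⟩
    change ((p : ℤ) ^ n) • (algebraMap A (Loc p A) a * locInv p A ^ n) = algebraMap A (Loc p A) a
    rw [zsmul_eq_mul, Int.cast_pow, Int.cast_natCast, mul_left_comm, pow_mul_locInv_pow, mul_one]
  exists_of_eq {a b} h := by
    obtain ⟨n, hn⟩ := exists_pow_mul_eq_zero (p := p) (a - b) (by
      rw [map_sub]
      exact sub_eq_zero.2 h)
    refine ⟨⟨_, n, rfl⟩, ?_⟩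
    change ((p : ℤ) ^ n) • a = ((p : ℤ) ^ n) • b
    rw [zsmul_eq_mul, zsmul_eq_mul, Int.cast_pow, Int.cast_natCast]
    exact sub_eq_zero.1 (by rw [← mul_sub, hn])

theorem algebraMap_loc_injective (htf : ∀ (n : ℕ) (a : A), (p : A) ^ n * a = 0 → a = 0) :
    Function.Injective (algebraMap A (Loc p A)) := by
  rw [injective_iff_map_eq_zero]
  intro a ha
  obtain ⟨n, hn⟩ := exists_pow_mul_eq_zero a ha
  exact htf n a hn

/-- The extension of an additive endomorphism of `A` to `A[1/p]`. -/
noncomputable def locMap (v : A →+ A) : Loc p A →+ Loc p A :=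
  (IsLocalizedModule.map (Submonoid.powers (p : ℤ)) (toLoc p A) (toLoc p A)
    v.toIntLinearMap).toAddMonoidHom

theorem locMap_algebraMap (v : A →+ A) (a : A) :
    locMap v (algebraMap A (Loc p A) a) = algebraMap A (Loc p A) (v a) :=
  IsLocalizedModule.map_apply (Submonoid.powers (p : ℤ)) (toLoc p A) (toLoc p A)
    v.toIntLinearMap a

theorem pow_mul_addMonoidHom {R S : Type*} [CommRing R] [CommRing S] (v : R →+ S) (n : ℕ) (x : R) :
    v ((p : R) ^ n * x) = (p : S) ^ n * v x := by
  have := map_nsmul v (p ^ n) x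
  simpa [nsmul_eq_mul] using this

theorem locMap_mul_locInv_pow (v : A →+ A) (a : A) (n : ℕ) :
    locMap v (algebraMap A (Loc p A) a * locInv p A ^ n)
      = algebraMap A (Loc p A) (v a) * locInv p A ^ n := by
  apply pow_mul_loc_cancel n
  rw [← pow_mul_addMonoidHom, mul_left_comm, pow_mul_locInv_pow, mul_left_comm, pow_mul_locInv_pow,
    mul_one, mul_one, locMap_algebraMap]

theorem locMap_smul (v : A →+ A) (a b : A) (h : ∀ c, v (b * c) = a * v c) (x : Loc p A) :
    locMap v (b • x) = a • locMap v x := by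
  obtain ⟨n, c, rfl⟩ := exists_eq_mul_locInv_pow x
  rw [locMap_mul_locInv_pow, Algebra.smul_def, Algebra.smul_def, ← mul_assoc, ← mul_assoc,
    ← map_mul, ← map_mul, locMap_mul_locInv_pow, h]

/-- The map induced on `A[1/p]/A` by an additive endomorphism of `A`. -/
noncomputable def locQuotMap (v : A →+ A) : LocQuot p A →+ LocQuot p A :=
  QuotientAddGroup.map _ _ (locMap v) (by
    rintro _ ⟨a, rfl⟩
    exact ⟨v a, (locMap_algebraMap v a).symm⟩)

theorem locQuotMap_mk (v : A →+ A) (x : Loc p A) :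
    locQuotMap v (Submodule.Quotient.mk x) = Submodule.Quotient.mk (locMap v x) := rfl

theorem locQuotMap_smul (v : A →+ A) (a b : A) (h : ∀ c, v (b * c) = a * v c) (x : LocQuot p A) :
    locQuotMap v (b • x) = a • locQuotMap v x := by
  obtain ⟨x, rfl⟩ := Submodule.Quotient.mk_surjective _ x
  rw [← Submodule.Quotient.mk_smul, locQuotMap_mk, locQuotMap_mk, locMap_smul v a b h,
    Submodule.Quotient.mk_smul]

variable (p A)

/-- The map `A/p^n → A[1/p]/A` that sends `a` to `a/p^n`. -/
noncomputable def frac (n : ℕ) : Ap p A n →ₗ[A] LocQuot p A :=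
  Submodule.liftQ (Ideal.span {(p : A) ^ n}) ((Submodule.mkQ _).comp
    (LinearMap.toSpanSingleton A (Loc p A) (locInv p A ^ n))) (by
      rw [Ideal.span_le, Set.singleton_subset_iff]
      refine (Submodule.Quotient.mk_eq_zero _).2 ⟨1, ?_⟩
      have := pow_mul_locInv_pow p A n
      simpa [Algebra.smul_def] using this.symm)

variable {p A}

theorem frac_mk (n : ℕ) (a : A) : frac p A n (Ideal.Quotient.mk _ a)
    = Submodule.Quotient.mk (algebraMap A (Loc p A) a * locInv p A ^ n) := by
  rw [← Algebra.smul_def]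
  rfl

theorem frac_injective (htf : ∀ (n : ℕ) (a : A), (p : A) ^ n * a = 0 → a = 0) (n : ℕ) :
    Function.Injective (frac p A n) := by
  rw [injective_iff_map_eq_zero]
  intro x hx
  obtain ⟨a, rfl⟩ := Ideal.Quotient.mk_surjective x
  rw [frac_mk] at hx
  obtain ⟨b, hb⟩ := (Submodule.Quotient.mk_eq_zero _).1 hx
  rw [Ideal.Quotient.eq_zero_iff_mem, Ideal.mem_span_singleton]
  refine ⟨b, algebraMap_loc_injective htf ?_⟩
  rw [map_mul, ← Algebra.linearMap_apply A (Loc p A) b, hb, map_pow, map_natCast, mul_left_comm,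
    pow_mul_locInv_pow, mul_one]

theorem frac_pow_mul (m n : ℕ) (a : A) :
    frac p A (m + n) (Ideal.Quotient.mk _ ((p : A) ^ m * a))
      = frac p A n (Ideal.Quotient.mk _ a) := by
  rw [frac_mk, frac_mk, map_mul, map_pow, map_natCast, pow_add]
  congr 1
  linear_combination (algebraMap A (Loc p A) a * locInv p A ^ n) * pow_mul_locInv_pow p A m

theorem locQuotMap_frac (v : A →+ A) (n : ℕ) (a : A) :
    locQuotMap v (frac p A n (Ideal.Quotient.mk _ a)) = frac p A n (Ideal.Quotient.mk _ (v a)) := by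
  rw [frac_mk, frac_mk, locQuotMap_mk, locMap_mul_locInv_pow]

/-- If `p^n x` is the class of zero, then `p^n x` comes from some `a ∈ A`, and `x = a/p^n`. With
`frac_injective`, `A/p^n` is the `p^n`-torsion of `A[1/p]/A`. -/
theorem exists_frac_eq (n : ℕ) (x : LocQuot p A) (hx : (p : A) ^ n • x = 0) :
    ∃ a : A, frac p A n (Ideal.Quotient.mk _ a) = x := by
  obtain ⟨x, rfl⟩ := Submodule.Quotient.mk_surjective _ x
  rw [← Submodule.Quotient.mk_smul, Submodule.Quotient.mk_eq_zero] at hx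
  obtain ⟨a, ha⟩ := hx
  refine ⟨a, ?_⟩
  rw [frac_mk]
  congr 1
  rw [← Algebra.linearMap_apply A (Loc p A) a, ha, Algebra.smul_def, map_pow, map_natCast]
  linear_combination x * pow_mul_locInv_pow p A n

end Loc

/-! ### `Ext¹(M, ω)` as `Hom(M, A[1/p]/A)`, compatibly with traces. -/

namespace DualizingData

variable {p : ℕ} [hp : Fact p.Prime] {A : Type u} [CommRing A] (D : DualizingData p A)

/-- The trace map of `φ` on `A ≅ ω`. -/
noncomputable def trA : A →+ A where
  toFun a := D.ι.symm (D.trFun (D.ι a))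
  map_zero' := by
    have := D.trFun_smul 0 0
    rw [zero_smul, smul_zero] at this
    rw [map_zero, this, map_zero]
  map_add' a b := by rw [map_add, trFun_add, map_add]

theorem trA_mul (a b : A) : D.trA (D.φ a * b) = a * D.trA b := by
  change D.ι.symm (D.trFun (D.ι (D.φ a • b))) = a • D.ι.symm (D.trFun (D.ι b))
  rw [map_smul, trFun_smul, map_smul]

theorem iota_symm_trFun_iterate (k : ℕ) (w : D.ω) :
    D.ι.symm (D.trFun^[k] w) = D.trA^[k] (D.ι.symm w) := by
  induction k generalizing w with
  | zero => rfl
  | succ k ih =>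
    rw [Function.iterate_succ_apply, ih, Function.iterate_succ_apply]
    congr 1
    change _ = D.ι.symm (D.trFun (D.ι (D.ι.symm w)))
    rw [D.ι.apply_symm_apply]

/-- The trace map of `φ` on `A[1/p]/A`. -/
noncomputable def trQ : LocQuot p A →+ LocQuot p A := locQuotMap D.trA

theorem trQ_smul (a : A) (x : LocQuot p A) : D.trQ (D.φ a • x) = a • D.trQ x :=
  locQuotMap_smul _ _ _ (D.trA_mul a) x

theorem pow_succ_apply (k : ℕ) (a : A) : (D.φ ^ (k + 1)) a = D.φ ((D.φ ^ k) a) := by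
  rw [pow_succ']; rfl

theorem pow_succ_apply' (k : ℕ) (a : A) : (D.φ ^ (k + 1)) a = (D.φ ^ k) (D.φ a) := by
  rw [pow_succ]; rfl

theorem iterate_smul {M : Type*} [AddCommGroup M] [Module A M] (t : M →+ M)
    (ht : ∀ (a : A) (x : M), t (D.φ a • x) = a • t x) (k : ℕ) (a : A) (x : M) :
    t^[k] ((D.φ ^ k) a • x) = a • t^[k] x := by
  induction k generalizing x with
  | zero => rfl
  | succ k ih => rw [Function.iterate_succ_apply, pow_succ_apply, ht, ih]; rfl

/-- The `k`-fold iterate of a `φ^{-1}`-linear endomorphism of `M`, as a map `φ^k_* M ⟶ M`. -/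
noncomputable def iterHom {M : Type u} [AddCommGroup M] [Module A M] (t : M →+ M)
    (ht : ∀ (a : A) (x : M), t (D.φ a • x) = a • t x) (k : ℕ) :
    (D.push k).obj (ModuleCat.of A M) ⟶ ModuleCat.of A M :=
  ModuleCat.ofHom (X := (D.push k).obj (ModuleCat.of A M)) (Y := ModuleCat.of A M)
  { toFun := t^[k]
    map_add' := fun x y => iterate_map_add t k x y
    map_smul' := fun a x => D.iterate_smul t ht k a x }

/-- The sequence `0 → ω → A[1/p] → A[1/p]/A → 0`. -/
noncomputable abbrev locSeq : ShortComplex (ModuleCat.{u} A) where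
  X₁ := D.ω
  X₂ := ModuleCat.of A (Loc p A)
  X₃ := ModuleCat.of A (LocQuot p A)
  f := ModuleCat.ofHom ((Algebra.linearMap A (Loc p A)).comp D.ι.symm.toLinearMap)
  g := ModuleCat.ofHom (Submodule.mkQ _)
  zero := by
    ext w
    exact (Submodule.Quotient.mk_eq_zero _).2 ⟨D.ι.symm w, rfl⟩

theorem locSeq_shortExact : D.locSeq.ShortExact where
  exact := by
    rw [ShortComplex.ShortExact.moduleCat_exact_iff_function_exact]
    intro (x : Loc p A)
    refine (Submodule.Quotient.mk_eq_zero _).trans ?_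
    constructor
    · rintro ⟨a, rfl⟩
      exact ⟨D.ι a, congrArg (algebraMap A (Loc p A)) (D.ι.symm_apply_apply a)⟩
    · rintro ⟨w, rfl⟩
      exact ⟨D.ι.symm w, rfl⟩
  mono_f := (ModuleCat.mono_iff_injective _).2 fun _ _ h =>
    D.ι.symm.injective (algebraMap_loc_injective D.pow_torsionFree h)
  epi_g := (ModuleCat.epi_iff_surjective _).2 (Submodule.mkQ_surjective _)

/-- The map `φ^k_*(ω → A[1/p] → A[1/p]/A) ⟶ (ω → A[1/p] → A[1/p]/A)` given by the trace. -/
noncomputable def locSeqTrace (k : ℕ) : D.locSeq.map (D.push k) ⟶ D.locSeq where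
  τ₁ := D.trIter k
  τ₂ := D.iterHom (locMap D.trA) (fun a x => locMap_smul _ _ _ (D.trA_mul a) x) k
  τ₃ := D.iterHom D.trQ D.trQ_smul k
  comm₁₂ := by
    ext (w : D.ω)
    change algebraMap A (Loc p A) (D.ι.symm (D.trFun^[k] w))
      = (locMap D.trA)^[k] (algebraMap A (Loc p A) (D.ι.symm w))
    rw [iota_symm_trFun_iterate]
    exact Function.Semiconj.iterate_right (f := algebraMap A (Loc p A))
      (fun a => (locMap_algebraMap D.trA a).symm) k _
  comm₂₃ := by
    ext (x : Loc p A)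
    change Submodule.Quotient.mk ((locMap D.trA)^[k] x)
      = D.trQ^[k] (Submodule.Quotient.mk x)
    exact Function.Semiconj.iterate_right
      (f := (Submodule.Quotient.mk : Loc p A → LocQuot p A)) (fun a => rfl) k _

/-- The connecting homomorphism `Hom(M, A[1/p]/A) → Ext¹(M, ω)`. -/
noncomputable def delta (M : ModuleCat.{u} A) :
    (M ⟶ ModuleCat.of A (LocQuot p A)) →+ Ext.{u} M D.ω 1 where
  toFun f := (Ext.mk₀ f).comp D.locSeq_shortExact.extClass (zero_add 1)
  map_zero' := by rw [Ext.mk₀_zero, Ext.zero_comp]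
  map_add' f g := by rw [Ext.mk₀_add, Ext.add_comp]

theorem delta_apply {M : ModuleCat.{u} A} (f : M ⟶ ModuleCat.of A (LocQuot p A)) :
    D.delta M f = (Ext.mk₀ f).comp D.locSeq_shortExact.extClass (zero_add 1) := rfl

theorem mk₀_comp_delta {M N : ModuleCat.{u} A} (h : N ⟶ M)
    (f : M ⟶ ModuleCat.of A (LocQuot p A)) :
    (Ext.mk₀ h).comp (D.delta M f) (zero_add 1) = D.delta N (h ≫ f) := by
  rw [delta_apply, delta_apply, Ext.mk₀_comp_mk₀_assoc]

/-- The exact functor `φ^k_*` carries the extension class of `locSeq` to that of its image, and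
`locSeqTrace` maps this image back to `locSeq`. Naturality of extension classes then trades the
trace on `ω` for the trace on `A[1/p]/A`. -/
theorem trace_delta (k : ℕ) {M N : ModuleCat.{u} A} (h : N ⟶ (D.push k).obj M)
    (f : M ⟶ ModuleCat.of A (LocQuot p A)) :
    D.trace k h (D.delta M f)
      = D.delta N (h ≫ (D.push k).map f ≫ D.iterHom D.trQ D.trQ_smul k) := by
  have h1 := ShortComplex.ShortExact.extClass_naturality
    (D.locSeq_shortExact.map_of_exact (D.push k)) D.locSeq_shortExact (D.locSeqTrace k)
  change (Ext.mk₀ h).comp ((((Ext.mk₀ f).comp D.locSeq_shortExact.extClass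
    (zero_add 1)).mapExactFunctor (D.push k)).comp (Ext.mk₀ (D.trIter k)) (add_zero 1))
      (zero_add 1) = _
  rw [Ext.mapExactFunctor_comp, Ext.mapExactFunctor_mk₀, Ext.mapExactFunctor_extClass]
  have h2 {L : ModuleCat.{u} A} (a : L ⟶ (D.locSeq.map (D.push k)).X₃) :
      ((Ext.mk₀ a).comp (D.locSeq_shortExact.map_of_exact (D.push k)).extClass
        (zero_add 1)).comp (Ext.mk₀ (D.locSeqTrace k).τ₁) (add_zero 1)
      = (Ext.mk₀ (a ≫ (D.locSeqTrace k).τ₃)).comp D.locSeq_shortExact.extClass (zero_add 1) := by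
    rw [Ext.comp_assoc_of_third_deg_zero, h1, Ext.mk₀_comp_mk₀_assoc]
  refine (congrArg (fun z => (Ext.mk₀ h).comp z (zero_add 1)) (h2 ((D.push k).map f))).trans ?_
  exact Ext.mk₀_comp_mk₀_assoc _ _ _

/-- An element of the kernel factors through `A[1/p]`, and there is no nonzero map to `A[1/p]` from
a module killed by `p^n`. -/
theorem delta_injective {M : ModuleCat.{u} A} (n : ℕ) (hM : ∀ x : M, (p : A) ^ n • x = 0) :
    Function.Injective (D.delta M) := by
  rw [injective_iff_map_eq_zero]
  intro f hf
  obtain ⟨g, hg⟩ := Ext.covariant_sequence_exact₃ M D.locSeq_shortExact (Ext.mk₀ f) (zero_add 1) hf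
  obtain ⟨g, rfl⟩ := (Ext.mk₀_bijective _ _).2 g
  have hg0 : g = 0 := by
    ext x
    apply pow_mul_loc_cancel (p := p) n
    have h1 : g.hom ((p : A) ^ n • x) = (p : A) ^ n • (g.hom x : Loc p A) := g.hom.map_smul _ _
    rw [hM, map_zero, Algebra.smul_def, map_pow, map_natCast] at h1
    rw [← h1]
    exact (mul_zero _).symm
  rw [hg0, Ext.mk₀_zero, Ext.zero_comp] at hg
  exact (Ext.mk₀_bijective _ _).1 (by rw [← hg, Ext.mk₀_zero])

theorem delta_surjective {M : ModuleCat.{u} A} (n : ℕ) (hM : ∀ x : M, (p : A) ^ n • x = 0) :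
    Function.Surjective (D.delta M) := by
  intro x
  -- On this group `p^n` acts as zero through `M` and invertibly through `A[1/p]`.
  have hz (y : Ext.{u} M (ModuleCat.of A (Loc p A)) 1) : y = 0 := by
    have h1 : ((p : A) ^ n • 𝟙 M) = 0 := by
      ext x
      exact hM x
    have h2 : (p : A) ^ n • y = 0 := by
      rw [← Ext.mk₀_id_comp y, ← Ext.smul_comp, ← Ext.mk₀_smul, h1, Ext.mk₀_zero, Ext.zero_comp]
    have h3 : ((p : A) ^ n • 𝟙 (ModuleCat.of A (Loc p A))) ≫ ModuleCat.ofHom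
        (LinearMap.mulLeft A (locInv p A ^ n)) = 𝟙 _ := by
      ext (x : Loc p A)
      change locInv p A ^ n * ((p : A) ^ n • x) = x
      rw [Algebra.smul_def, map_pow, map_natCast]
      linear_combination x * pow_mul_locInv_pow p A n
    rw [← Ext.comp_mk₀_id y, ← h3, Linear.smul_comp, Category.id_comp, Ext.mk₀_smul, Ext.comp_smul,
      ← Ext.smul_comp, h2, Ext.zero_comp]
  obtain ⟨y, hy⟩ := Ext.covariant_sequence_exact₁ M D.locSeq_shortExact x (hz _) (zero_add 1)
  obtain ⟨f, rfl⟩ := (Ext.mk₀_bijective _ _).2 y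
  exact ⟨f, hy⟩

end DualizingData

/-! ### Restriction, `V` and ghost components on truncated Witt vectors. -/

section Witt

variable (p : ℕ) [hp : Fact p.Prime] (A : Type u) [CommRing A]

/-- The identities relating `F` and `V` require characteristic `p`, which fails only when `p` is a
unit in `A`; then `A/p` is zero and they are trivial. -/
theorem subsingleton_or_charP :
    Subsingleton (A ⧸ Ideal.span {(p : A)}) ∨ CharP (A ⧸ Ideal.span {(p : A)}) p := by
  rcases subsingleton_or_nontrivial (A ⧸ Ideal.span {(p : A)}) with h | h
  · exact Or.inl h
  · refine Or.inr ((CharP.charP_iff_prime_eq_zero hp.out).2 ?_)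
    rw [← map_natCast (Ideal.Quotient.mk (Ideal.span {(p : A)})), Ideal.Quotient.eq_zero_iff_mem]
    exact Ideal.mem_span_singleton_self _

variable {p A}

theorem subsingleton_W [Subsingleton (A ⧸ Ideal.span {(p : A)})] (n : ℕ) : Subsingleton (W p A n) :=
  ⟨fun _ _ => TruncatedWittVector.ext fun _ => Subsingleton.elim _ _⟩

theorem coeff_ver (n : ℕ) (x : W p A n) (i : Fin (n + 1)) :
    (ver n x).coeff i = (Fin.cons 0 fun i => x.coeff i : Fin (n + 1) → _) i :=
  TruncatedWittVector.coeff_mk _ _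

theorem ver_truncate (n : ℕ) (X : WittVector p (A ⧸ Ideal.span {(p : A)})) :
    ver n (WittVector.truncate n X) = WittVector.truncate (n + 1) (WittVector.verschiebung X) := by
  apply TruncatedWittVector.ext
  intro i
  rw [coeff_ver, WittVector.coeff_truncate]
  refine Fin.cases ?_ (fun j => ?_) i
  · simp [WittVector.verschiebung_coeff_zero]
  · simp [WittVector.verschiebung_coeff_succ, WittVector.coeff_truncate]

theorem res_truncate {m n : ℕ} (h : m ≤ n) (X : WittVector p (A ⧸ Ideal.span {(p : A)})) :
    res h (WittVector.truncate n X) = WittVector.truncate m X :=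
  TruncatedWittVector.truncate_wittVector_truncate h X

theorem res_surjective {m n : ℕ} (h : m ≤ n) : Function.Surjective (res (p := p) (A := A) h) := by
  intro x
  obtain ⟨X, rfl⟩ := WittVector.truncate_surjective p m _ x
  exact ⟨WittVector.truncate n X, res_truncate h X⟩

theorem res_proj {m n : ℕ} (h : m ≤ n) (y : WittVector p A) :
    res h (proj p A n y) = proj p A m y :=
  res_truncate h (WittVector.map (Ideal.Quotient.mk (Ideal.span {(p : A)})) y)

theorem ver_proj (n : ℕ) (y : WittVector p A) :
    ver n (proj p A n y) = proj p A (n + 1) (WittVector.verschiebung y) :=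
  coeff_ver_proj n y

theorem ghost_proj (n : ℕ) (y : WittVector p A) :
    ghost n (proj p A n y) = Ideal.Quotient.mk _ (WittVector.ghostComponent (n - 1) y) :=
  ghostFun_proj n y

theorem exists_ver_of_res_eq_zero (n : ℕ) (x : W p A (n + 1))
    (hx : res (Nat.succ_le_succ n.zero_le) x = (0 : W p A 1)) : ∃ y, x = ver n y := by
  refine ⟨TruncatedWittVector.mk p fun i => x.coeff i.succ, TruncatedWittVector.ext fun i => ?_⟩
  rw [coeff_ver]
  refine Fin.cases ?_ (fun j => ?_) i
  · have h1 := congrArg (fun z : W p A 1 => z.coeff 0) hx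
    rw [TruncatedWittVector.coeff_truncate] at h1
    exact h1.trans (TruncatedWittVector.coeff_zero _ _ _ _)
  · rw [Fin.cons_succ, TruncatedWittVector.coeff_mk]

theorem res_ver (n : ℕ) (y : W p A n) :
    res (Nat.succ_le_succ n.zero_le) (ver n y) = (0 : W p A 1) := by
  apply TruncatedWittVector.ext
  intro i
  obtain rfl := Subsingleton.elim i 0
  rw [TruncatedWittVector.coeff_truncate, TruncatedWittVector.coeff_zero]
  exact TruncatedWittVector.coeff_mk _ _

end Witt

/-! ### Identities between `F`, `V` and Teichmüller lifts. -/

namespace DualizingData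

variable {p : ℕ} [hp : Fact p.Prime] {A : Type u} [CommRing A] (D : DualizingData p A)

theorem coeff_F (n : ℕ) (x : W p A n) (i : Fin n) : (D.F n x).coeff i = x.coeff i ^ p :=
  TruncatedWittVector.coeff_mk _ _

theorem F_truncate [CharP (A ⧸ Ideal.span {(p : A)}) p] (n : ℕ)
    (X : WittVector p (A ⧸ Ideal.span {(p : A)})) :
    D.F n (WittVector.truncate n X) = WittVector.truncate n (WittVector.frobenius X) := by
  apply TruncatedWittVector.ext
  intro i
  rw [coeff_F, WittVector.coeff_truncate, WittVector.coeff_truncate,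
    WittVector.coeff_frobenius_charP]

/-- The relation `p = VF` of characteristic `p`, in truncated form. -/
theorem natCast_mul_eq_ver (n : ℕ) (x : W p A (n + 1)) :
    (p : W p A (n + 1)) * x = ver n (res n.le_succ (D.F (n + 1) x)) := by
  rcases subsingleton_or_charP p A with h | h
  · have := subsingleton_W (p := p) (A := A) (n + 1)
    exact Subsingleton.elim _ _
  · obtain ⟨X, rfl⟩ := WittVector.truncate_surjective p (n + 1) _ x
    rw [F_truncate, res_truncate, ver_truncate, WittVector.verschiebung_frobenius, map_mul,
      map_natCast, mul_comm]

/-- The projection formula for `V`. It makes `V` linear from `F^{e+1}_* W_n` to `F^e_* W_{n+1}`,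
hence the shift in `e` in the lower row of the diagram. -/
theorem ver_mul (n : ℕ) (y : W p A n) (x : W p A (n + 1)) :
    ver n y * x = ver n (y * D.F n (res n.le_succ x)) := by
  rcases subsingleton_or_charP p A with h | h
  · have := subsingleton_W (p := p) (A := A) (n + 1)
    exact Subsingleton.elim _ _
  · obtain ⟨X, rfl⟩ := WittVector.truncate_surjective p (n + 1) _ x
    obtain ⟨Y, rfl⟩ := WittVector.truncate_surjective p n _ y
    rw [res_truncate, F_truncate, ver_truncate, ← map_mul, ← map_mul, ver_truncate,
      WittVector.verschiebung_mul_frobenius]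

/-- Multiplication by `p` factors through `V`, hence through Witt vectors of length one less. -/
theorem pow_mul_W (D : DualizingData p A) (n : ℕ) (x : W p A n) : (p : W p A n) ^ n * x = 0 := by
  induction n with
  | zero => exact TruncatedWittVector.ext fun i => i.elim0
  | succ n ih =>
    rw [pow_succ, mul_assoc, D.natCast_mul_eq_ver, ← pow_mul_addMonoidHom, ih, map_zero]

theorem F_ver (n : ℕ) (y : W p A n) : D.F (n + 1) (ver n y) = ver n (D.F n y) := by
  rcases subsingleton_or_charP p A with h | h
  · have := subsingleton_W (p := p) (A := A) (n + 1)
    exact Subsingleton.elim _ _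
  · obtain ⟨Y, rfl⟩ := WittVector.truncate_surjective p n _ y
    rw [F_truncate, ver_truncate, F_truncate, ver_truncate]
    congr 1
    ext i
    rw [WittVector.coeff_frobenius_charP]
    rcases i with _ | i
    · simp [WittVector.verschiebung_coeff_zero, hp.out.ne_zero]
    · rw [WittVector.verschiebung_coeff_succ, WittVector.verschiebung_coeff_succ,
        WittVector.coeff_frobenius_charP]

theorem F_pow_ver (n e : ℕ) (y : W p A n) :
    (D.F (n + 1) ^ e) (ver n y) = ver n ((D.F n ^ e) y) := by
  induction e generalizing y with
  | zero => rfl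
  | succ k ih =>
    rw [pow_succ, pow_succ]
    change (D.F (n + 1) ^ k) (D.F (n + 1) (ver n y)) = ver n ((D.F n ^ k) (D.F n y))
    rw [F_ver, ih]

theorem F_pow_succ_apply (n e : ℕ) (x : W p A n) : (D.F n ^ (e + 1)) x = D.F n ((D.F n ^ e) x) := by
  rw [pow_succ']; rfl

theorem F_teich (n : ℕ) (a : A ⧸ Ideal.span {(p : A)}) : D.F n (teich n a) = teich n (a ^ p) := by
  apply TruncatedWittVector.ext
  intro i
  rw [coeff_F, teich, teich, WittVector.coeff_truncate,
    WittVector.coeff_truncate]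
  rcases h : (i : ℕ) with _ | j
  · rw [WittVector.teichmuller_coeff_zero, WittVector.teichmuller_coeff_zero]
  · rw [WittVector.teichmuller_coeff_pos p _ _ j.succ_pos,
      WittVector.teichmuller_coeff_pos p _ _ j.succ_pos, zero_pow hp.out.ne_zero]

theorem F_pow_teich (n e : ℕ) (a : A ⧸ Ideal.span {(p : A)}) :
    (D.F n ^ e) (teich n a) = teich n (a ^ p ^ e) := by
  induction e with
  | zero => simp
  | succ k ih => rw [F_pow_succ_apply, ih, F_teich, ← pow_mul, ← pow_succ]

theorem teich_mk (n : ℕ) (f : A) :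
    teich n (Ideal.Quotient.mk _ f) = proj p A n (WittVector.teichmuller p f) := by
  rw [teich, proj, RingHom.comp_apply, WittVector.map_teichmuller]

theorem ghost_teich (n : ℕ) (f : A) : ghost n (teich n (Ideal.Quotient.mk (Ideal.span {(p : A)}) f))
    = Ideal.Quotient.mk _ (f ^ p ^ (n - 1)) := by
  rw [teich_mk, ghost_proj, WittVector.ghostComponent_teichmuller]

/-! ### Elements of `W_nω` as functionals, and the explicit formula for `Ψ`. -/

theorem pow_smul_WMod (n : ℕ) (x : D.WMod n) : (p : A) ^ n • x = 0 := by
  change HMul.hMul (α := W p A n) (β := W p A n) (D.sW n ((p : A) ^ n)) x = (0 : W p A n)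
  rw [map_pow, map_natCast]
  exact D.pow_mul_W n x

/-- The isomorphism `Hom(W_n(A/p), A[1/p]/A) ≅ W_nω_{A/p}`. -/
noncomputable def deltaW (n : ℕ) : (D.WMod n ⟶ ModuleCat.of A (LocQuot p A)) ≃+ D.Wω n :=
  AddEquiv.ofBijective (D.delta (D.WMod n))
    ⟨D.delta_injective n (D.pow_smul_WMod n), D.delta_surjective n (D.pow_smul_WMod n)⟩

/-- The homomorphism `W_n(A/p) → A[1/p]/A` that corresponds to an element of `W_nω_{A/p}`. -/
noncomputable def ev {n : ℕ} (w : D.Wω n) : W p A n →+ LocQuot p A :=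
  ((D.deltaW n).symm w).hom.toAddMonoidHom

theorem ev_delta {n : ℕ} (f : D.WMod n ⟶ ModuleCat.of A (LocQuot p A)) (x : W p A n) :
    D.ev (D.delta (D.WMod n) f) x = f.hom x := by
  change ((D.deltaW n).symm ((D.deltaW n) f)).hom x = _
  rw [AddEquiv.symm_apply_apply]

theorem exists_delta {n : ℕ} (w : D.Wω n) :
    ∃ f : D.WMod n ⟶ ModuleCat.of A (LocQuot p A), D.delta (D.WMod n) f = w :=
  (D.deltaW n).surjective w

theorem ev_ext {n : ℕ} {w w' : D.Wω n} (h : ∀ x, D.ev w x = D.ev w' x) : w = w' := by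
  obtain ⟨f, rfl⟩ := D.exists_delta w
  obtain ⟨f', rfl⟩ := D.exists_delta w'
  congr 1
  ext (x : W p A n)
  rw [← ev_delta, h, ev_delta]

theorem exists_ev {n : ℕ} (f : W p A n →+ LocQuot p A)
    (hf : ∀ a x, f (D.sW n a * x) = a • f x) : ∃ w, D.ev w = f :=
  ⟨D.delta (D.WMod n) (ModuleCat.ofHom (X := D.WMod n) (Y := ModuleCat.of A (LocQuot p A))
    { toFun := f, map_add' := map_add f, map_smul' := hf }),
    AddMonoidHom.ext fun x => D.ev_delta _ x⟩

theorem ev_sW_mul {n : ℕ} (w : D.Wω n) (a : A) (x : W p A n) :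
    D.ev w (D.sW n a * x) = a • D.ev w x :=
  ((D.deltaW n).symm w).hom.map_smul a x

theorem ev_add {n : ℕ} (v w : D.Wω n) (x : W p A n) : D.ev (v + w) x = D.ev v x + D.ev w x := by
  obtain ⟨f, rfl⟩ := D.exists_delta v
  obtain ⟨g, rfl⟩ := D.exists_delta w
  rw [← map_add, ev_delta, ev_delta, ev_delta]
  rfl

theorem ev_zero {n : ℕ} (x : W p A n) : D.ev (0 : D.Wω n) x = 0 := by
  rw [← map_zero (D.delta (D.WMod n)), ev_delta]
  rfl

theorem ev_smul {n : ℕ} (α : W p A n) (w : D.Wω n) (x : W p A n) :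
    D.ev (α • w) x = D.ev w (α * x) := by
  obtain ⟨f, rfl⟩ := D.exists_delta w
  rw [smul_def, mk₀_comp_delta, ev_delta, ev_delta]
  rfl

theorem ev_T {m n : ℕ} (h : m ≤ n) (w : D.Wω m) (x : W p A n) :
    D.ev (D.T h w) x = D.ev w (res h x) := by
  obtain ⟨f, rfl⟩ := D.exists_delta w
  change D.ev ((Ext.mk₀ (D.resHom h)).comp _ (zero_add 1)) x = _
  rw [mk₀_comp_delta, ev_delta, ev_delta]
  rfl

theorem ev_trF {n : ℕ} (e : ℕ) (w : D.Wω n) (x : W p A n) :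
    D.ev (D.trF n e w) x = D.trQ^[e] (D.ev w ((D.F n ^ e) x)) := by
  obtain ⟨f, rfl⟩ := D.exists_delta w
  rw [trF, trace_delta, ev_delta, ev_delta]
  rfl

theorem T_injective {m n : ℕ} (h : m ≤ n) : Function.Injective (D.T h) := by
  intro v w hvw
  refine D.ev_ext fun x => ?_
  obtain ⟨x, rfl⟩ := res_surjective h x
  rw [← ev_T, ← ev_T, hvw]

/-- Multiplication by `1/p^n`, as a family of homomorphisms `A/p^n → A[1/p]/A`. -/
noncomputable def fracHom (n : ℕ) (a : A) : D.ApMod n ⟶ ModuleCat.of A (LocQuot p A) :=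
  ModuleCat.ofHom ((frac p A n).comp (LinearMap.lsmul A (Ap p A n) a))

theorem fracHom_mk (n : ℕ) (a b : A) :
    (D.fracHom n a).hom (Ideal.Quotient.mk _ b) = frac p A n (Ideal.Quotient.mk _ (a * b)) := rfl

/-- The map from `0 → A → A → A/p^n → 0` to `0 → ω → A[1/p] → A[1/p]/A → 0` given by `a/p^n`. -/
noncomputable def seqToLocSeq (n : ℕ) (a : A) : D.seq n ⟶ D.locSeq where
  τ₁ := D.homOf (D.ι a)
  τ₂ := ModuleCat.ofHom (LinearMap.toSpanSingleton A (Loc p A)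
    (algebraMap A (Loc p A) a * locInv p A ^ n))
  τ₃ := D.fracHom n a
  comm₁₂ := by
    ext
    change algebraMap A (Loc p A) (D.ι.symm ((1 : A) • D.ι a))
      = ((p : A) ^ n * 1) • (algebraMap A (Loc p A) a * locInv p A ^ n)
    rw [one_smul, mul_one, D.ι.symm_apply_apply, Algebra.smul_def, map_pow, map_natCast,
      mul_left_comm, pow_mul_locInv_pow, mul_one]
  comm₂₃ := by
    ext
    change Submodule.Quotient.mk ((1 : A) • (algebraMap A (Loc p A) a * locInv p A ^ n))
      = (D.fracHom n a).hom (Ideal.Quotient.mk _ 1)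
    rw [fracHom_mk, mul_one, one_smul, frac_mk]

/-- `ι_n` is defined through `0 → A → A → A/p^n → 0`, while traces are computed through `locSeq`.
Naturality along `seqToLocSeq` shows that `ι_n(a)` is the functional `b ↦ ab/p^n`. -/
theorem connecting_eq_delta (n : ℕ) (a : A) :
    D.connecting n a = D.delta (D.ApMod n) (D.fracHom n a) :=
  ShortComplex.ShortExact.extClass_naturality (D.seq_shortExact n) D.locSeq_shortExact
    (D.seqToLocSeq n a)

theorem u_mk (n : ℕ) (a : A) :
    D.u n (Ideal.Quotient.mk _ a) = Ideal.Quotient.mk _ (D.trA a) := by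
  rw [u, LinearEquiv.symm_apply_eq, iota_mk, iota_mk, connecting_eq_delta, connecting_eq_delta,
    trace_delta]
  congr 1
  refine ModuleCat.hom_ext (LinearMap.ext fun (x : Ap p A n) => ?_)
  obtain ⟨x, rfl⟩ := Ideal.Quotient.mk_surjective x
  change D.trQ ((D.fracHom n a).hom (Ideal.Quotient.mk _ (D.φ x))) = _
  rw [fracHom_mk, fracHom_mk, trQ, locQuotMap_frac, mul_comm, trA_mul, mul_comm]

theorem u_iterate_mk (n k : ℕ) (a : A) :
    (D.u n)^[k] (Ideal.Quotient.mk _ a) = Ideal.Quotient.mk _ (D.trA^[k] a) :=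
  (Function.Semiconj.iterate_right (f := Ideal.Quotient.mk (Ideal.span {(p : A) ^ n}))
    (fun a => (D.u_mk n a).symm) k a).symm

theorem ev_lam (n : ℕ) (g : Ap p A n) (x : W p A n) :
    D.ev (D.lam n g) x = D.trQ^[n - 1] (frac p A n (g * ghost n x)) := by
  obtain ⟨g, rfl⟩ := Ideal.Quotient.mk_surjective g
  change D.ev (D.trace (n - 1) (D.ghostHom n) (D.iota n (Ideal.Quotient.mk _ g))) x = _
  rw [iota_mk, connecting_eq_delta, trace_delta, ev_delta]
  obtain ⟨y, hy⟩ := Ideal.Quotient.mk_surjective (ghost n x)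
  change D.trQ^[n - 1] ((D.fracHom n g).hom (ghost n x)) = _
  rw [← hy, fracHom_mk, map_mul]

theorem trQ_iterate_frac (k n : ℕ) (a : A) :
    D.trQ^[k] (frac p A n (Ideal.Quotient.mk _ a))
      = frac p A n (Ideal.Quotient.mk _ (D.trA^[k] a)) :=
  (Function.Semiconj.iterate_right
    (f := fun a => frac p A n (Ideal.Quotient.mk (Ideal.span {(p : A) ^ n}) a))
    (fun a => (locQuotMap_frac D.trA n a).symm) k a).symm

/-- The explicit description of `Ψ^e_n`. -/
theorem ev_Psi (e n : ℕ) (hn : 1 ≤ n) (g : Ap p A n) (α x : W p A n) :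
    D.ev ((D.Psi e n g).app α) x
      = D.trQ^[e + n - 1] (frac p A n (g * ghost n (α * (D.F n ^ e) x))) := by
  change D.ev (D.trF n e (α • D.lam n g)) x = _
  rw [ev_trF, ev_smul, ev_lam, Nat.add_sub_assoc hn, Function.iterate_add_apply]

/-- A lift `y` to `W(A)` gives a ghost component in `A` itself. One `y` serves all lengths at once,
so that formulas for different `n` can be compared by congruences between ghost components. -/
theorem ev_Psi_mk (e n : ℕ) (hn : 1 ≤ n) (g : A) (α x : W p A n) (y : WittVector p A)
    (hy : proj p A n y = α * (D.F n ^ e) x) :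
    D.ev ((D.Psi e n (Ideal.Quotient.mk _ g)).app α) x
      = frac p A n (Ideal.Quotient.mk _ (D.trA^[e + n - 1]
          (g * WittVector.ghostComponent (n - 1) y))) := by
  rw [ev_Psi _ _ _ hn, ← hy, ghost_proj, ← map_mul, trQ_iterate_frac]

theorem Dual.ev_ext {D : DualizingData p A} {e n : ℕ} {ψ χ : D.Dual e n}
    (h : ∀ α x, D.ev (ψ.app α) x = D.ev (χ.app α) x) : ψ = χ :=
  Dual.ext fun α => D.ev_ext fun x => h α x

/-- A homomorphism `ψ` is determined by the values of `ψ(α)` at `1`. -/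
theorem Dual.ev_app {D : DualizingData p A} {e n : ℕ} (ψ : D.Dual e n) (α x : W p A n) :
    D.ev (ψ.app α) x = D.ev (ψ.app ((D.F n ^ e) x * α)) 1 := by
  rw [Dual.app_smul, ev_smul, mul_one]

/-! ### Perfectness of the trace, integrally and modulo `p`. -/

/-- The module `φ_* A`. -/
def PhiMod {p : ℕ} {A : Type u} [CommRing A] (_ : DualizingData p A) : Type u := A

instance : CommRing D.PhiMod := inferInstanceAs (CommRing A)

instance : Algebra A D.PhiMod := D.φ.toAlgebra

/-- A `φ^{-1}`-linear map as an `A`-linear map on `φ_* A`. -/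
def linearOfSemilinear {M : Type*} [AddCommGroup M] [Module A M] (h : A →+ M)
    (hh : ∀ a b, h (D.φ a * b) = a • h b) : D.PhiMod →ₗ[A] M where
  toFun := h
  map_add' := map_add h
  map_smul' := hh

theorem trA_perfect (h : A →+ A) (hh : ∀ a b, h (D.φ a * b) = a * h b) :
    ∃! w, ∀ b, h b = D.trA (b * w) := by
  have key (w : D.ω) (b : A) : D.ι (D.trA (b * D.ι.symm w)) = D.tr.hom (b • w : D.ω) := by
    change D.ι (D.ι.symm (D.trFun (D.ι (b • D.ι.symm w)))) = _
    rw [D.ι.apply_symm_apply, map_smul, D.ι.apply_symm_apply]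
    rfl
  obtain ⟨w, hw, hu⟩ := D.tr_perfect (ModuleCat.ofHom
    (X := (ModuleCat.restrictScalars D.φ).obj (ModuleCat.of A A))
    { toFun := fun b : A => D.ι (h b)
      map_add' := fun a b : A =>
        (congrArg D.ι (map_add h a b)).trans (map_add D.ι (h a) (h b))
      map_smul' := fun (a : A) (b : A) => (congrArg D.ι (hh a b)).trans (map_smul D.ι a (h b)) })
  refine ⟨D.ι.symm w, fun b => D.ι.injective ?_, fun v hv => ?_⟩
  · rw [key]
    exact hw b
  · rw [LinearEquiv.eq_symm_apply]
    refine hu _ fun b => ?_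
    rw [← key, D.ι.symm_apply_apply, ← hv]
    rfl

theorem trA_pow_mul (n : ℕ) (a : A) : D.trA ((p : A) ^ n * a) = (p : A) ^ n * D.trA a :=
  pow_mul_addMonoidHom _ _ _

theorem pow_dvd_trA {n : ℕ} {a : A} (h : (p : A) ^ n ∣ a) : (p : A) ^ n ∣ D.trA a := by
  obtain ⟨b, rfl⟩ := h
  exact ⟨_, D.trA_pow_mul n b⟩

theorem pow_mul_cancel (D : DualizingData p A) (n : ℕ) {a b : A}
    (h : (p : A) ^ n * a = (p : A) ^ n * b) : a = b :=
  sub_eq_zero.1 (D.pow_torsionFree n _ (by rw [mul_sub, h, sub_self]))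

/-- The map `b ↦ trA(bw)/p^n` is again `φ⁻¹`-linear, so it is `b ↦ trA(bv)` for some `v`; uniqueness
in `trA_perfect` gives `w = p^n v`. -/
theorem pow_dvd_of_trA {n : ℕ} {w : A} (h : ∀ b, (p : A) ^ n ∣ D.trA (b * w)) :
    (p : A) ^ n ∣ w := by
  choose c hc using h
  obtain ⟨v, hv, -⟩ := D.trA_perfect
    { toFun := c
      map_zero' := D.pow_mul_cancel n (by rw [← hc]; simp)
      map_add' := fun a b => D.pow_mul_cancel n (by
        rw [mul_add, ← hc, ← hc, ← hc, add_mul, map_add]) }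
    (fun a b => D.pow_mul_cancel n (by
      change _ * c _ = _ * (a * c b)
      rw [mul_left_comm, ← hc, ← hc, mul_assoc, trA_mul]))
  refine ⟨v, (D.trA_perfect (D.trA.comp (AddMonoidHom.mulRight w)) fun a b => ?_).unique
    (fun b => rfl) fun b => ?_⟩
  · change D.trA (D.φ a * b * w) = a * D.trA (b * w)
    rw [mul_assoc, trA_mul]
  · change D.trA (b * w) = _
    rw [mul_left_comm, trA_pow_mul, ← hv b]
    exact hc b

theorem trA_iterate_mul (k : ℕ) (a b : A) :
    D.trA^[k] ((D.φ ^ k) a * b) = a * D.trA^[k] b :=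
  D.iterate_smul D.trA D.trA_mul k a b

theorem pow_dvd_of_trA_iterate (k : ℕ) {n : ℕ} {w : A}
    (h : ∀ b, (p : A) ^ n ∣ D.trA^[k] (b * w)) : (p : A) ^ n ∣ w := by
  induction k generalizing w with
  | zero => simpa using h 1
  | succ k ih =>
    refine D.pow_dvd_of_trA fun b => ih fun c => ?_
    rw [← trA_mul, ← mul_assoc, ← Function.iterate_succ_apply]
    exact h _

/-- Duality mod `p` for `φ^e`, from the case of `φ`, which is the hypothesis `H`. For fixed `b`, the
map `a ↦ h(φ^e(a) b)` is `a ↦ trA(a w(b))`; then `b ↦ w(b)` mod `p` is `φ^{-e}`-linear and the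
induction hypothesis applies to it. -/
theorem exists_trA_iterate_eq
    (H : ∀ h : A →+ Ap p A 1, (∀ a b, h (D.φ a * b) = a • h b) →
      ∃ g, ∀ b, h b = Ideal.Quotient.mk _ (D.trA (b * g)))
    (e : ℕ) (h : A →+ Ap p A 1) (hh : ∀ a b, h ((D.φ ^ e) a * b) = a • h b) :
    ∃ g, ∀ b, h b = Ideal.Quotient.mk _ (D.trA^[e] (b * g)) := by
  induction e generalizing h with
  | zero =>
    obtain ⟨g, hg⟩ := Ideal.Quotient.mk_surjective (h 1)
    refine ⟨g, fun b => ?_⟩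
    have := hh b 1
    rw [mul_one] at this
    refine Eq.trans this ?_
    rw [← hg]
    rfl
  | succ e ih =>
    have mk_eq {a b : A} : (Ideal.Quotient.mk _ a : Ap p A 1) = Ideal.Quotient.mk _ b
        ↔ (p : A) ^ 1 ∣ a - b := by
      rw [Ideal.Quotient.eq, Ideal.mem_span_singleton]
    have h1 (b : A) : ∃ w, ∀ a, h ((D.φ ^ e) a * b) = Ideal.Quotient.mk _ (D.trA (a * w)) := by
      refine H (h.comp ((AddMonoidHom.mulRight b).comp (D.φ ^ e).toAddMonoidHom)) fun c a => ?_
      change h ((D.φ ^ e) (D.φ c * a) * b) = c • h ((D.φ ^ e) a * b)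
      rw [map_mul (D.φ ^ e), ← pow_succ_apply', mul_assoc, hh]
    choose w hw using h1
    -- The chosen `w(b)` is unique mod `p`, which is why it is additive and semilinear there.
    have huniq (x y : A) (hxy : ∀ a, (Ideal.Quotient.mk _ (D.trA (a * x)) : Ap p A 1)
        = Ideal.Quotient.mk _ (D.trA (a * y))) :
        (Ideal.Quotient.mk _ x : Ap p A 1) = Ideal.Quotient.mk _ y := by
      rw [mk_eq]
      refine D.pow_dvd_of_trA fun b => ?_
      rw [mul_sub, map_sub]
      exact mk_eq.1 (hxy b)
    obtain ⟨g, hg⟩ := ih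
      (AddMonoidHom.mk' (fun b => Ideal.Quotient.mk _ (w b)) fun b c => by
        rw [← map_add]
        refine huniq _ _ fun a => ?_
        rw [mul_add, map_add, map_add, ← hw, ← hw, ← hw, mul_add, map_add])
      (fun c b => by
        change (Ideal.Quotient.mk _ (w _) : Ap p A 1) = Ideal.Quotient.mk _ (c * w b)
        refine huniq _ _ fun a => ?_
        rw [← mul_assoc, ← hw, ← hw, map_mul (D.φ ^ e), mul_assoc])
    refine ⟨g, fun b => ?_⟩
    have h2 := hw b 1
    rw [map_one, one_mul, one_mul] at h2
    rw [h2, mk_eq, Function.iterate_succ_apply', ← map_sub]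
    exact D.pow_dvd_trA (mk_eq.1 (hg b))

/-- As `φ_* A` is projective, `h` lifts to a functional with values in `A`, to which perfectness
applies. -/
theorem exists_trA_eq_of_free [Module.Free A D.PhiMod] (h : A →+ Ap p A 1)
    (hh : ∀ a b, h (D.φ a * b) = a • h b) :
    ∃ g, ∀ b, h b = Ideal.Quotient.mk _ (D.trA (b * g)) := by
  obtain ⟨k, hk⟩ := Module.projective_lifting_property (Submodule.mkQ (Ideal.span {(p : A) ^ 1}))
    (D.linearOfSemilinear h hh) (Submodule.mkQ_surjective _)
  obtain ⟨g, hg, -⟩ := D.trA_perfect ⟨⟨fun a : A => k a, map_zero k⟩, map_add k⟩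
    (fun a b => k.map_smul a b)
  refine ⟨g, fun b => ?_⟩
  rw [← hg]
  exact (LinearMap.congr_fun hk b).symm

/-- The image of `trA` is an ideal. A coordinate functional of a basis has the form `b ↦ trA(bg)`
and takes the value `1`. -/
theorem trA_surjective_of_free [Nontrivial A] [Module.Free A D.PhiMod] :
    Function.Surjective D.trA := by
  let I : Ideal A :=
    { carrier := Set.range D.trA
      add_mem' := by
        rintro _ _ ⟨a, rfl⟩ ⟨b, rfl⟩
        exact ⟨a + b, map_add _ _ _⟩
      zero_mem' := ⟨0, map_zero _⟩
      smul_mem' := by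
        rintro c _ ⟨a, rfl⟩
        exact ⟨_, D.trA_mul c a⟩ }
  let b := Module.Free.chooseBasis A D.PhiMod
  have hn : Nontrivial D.PhiMod := inferInstanceAs (Nontrivial A)
  obtain ⟨i⟩ := b.index_nonempty
  obtain ⟨g, hg, -⟩ := D.trA_perfect ⟨⟨fun a : A => b.coord i a, map_zero (b.coord i)⟩,
    map_add (b.coord i)⟩ (fun a c => (b.coord i).map_smul a c)
  have h1 : (1 : A) ∈ I := ⟨HMul.hMul (α := A) (β := A) (b i) g, (hg _).symm.trans (by
    change b.coord i (b i) = 1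
    simp)⟩
  intro a
  have := I.mul_mem_left a h1
  rwa [mul_one] at this

end DualizingData

/-! ### Regular local rings, regular sequences and a freeness criterion. -/

section Regular

open IsLocalRing RingTheory.Sequence

/-- Exchange argument: when `x` is written in terms of the generators, some coefficient is a unit,
since otherwise `x ∈ m²`. The corresponding generator can be replaced by `x`. -/
theorem exists_ofList_cons_eq {R : Type*} [CommRing R] [IsLocalRing R] (l : List R)
    (hl : Ideal.ofList l ≤ maximalIdeal R) (x : R) (hx : x ∈ Ideal.ofList l)
    (hx2 : x ∉ maximalIdeal R * maximalIdeal R) :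
    ∃ l' : List R, l'.length + 1 = l.length ∧ Ideal.ofList (x :: l') = Ideal.ofList l := by
  induction l generalizing x with
  | nil =>
    rw [Ideal.ofList_nil, Ideal.mem_bot] at hx
    exact absurd (hx ▸ zero_mem _) hx2
  | cons y l ih =>
    have hl' : Ideal.ofList l ≤ maximalIdeal R := by
      rw [Ideal.ofList_cons] at hl
      exact le_sup_right.trans hl
    have hy : y ∈ maximalIdeal R := hl (Ideal.subset_span List.mem_cons_self)
    rw [Ideal.ofList_cons, Submodule.mem_sup] at hx
    obtain ⟨_, hay, z, hz, rfl⟩ := hx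
    obtain ⟨a, rfl⟩ := Ideal.mem_span_singleton'.1 hay
    by_cases ha : IsUnit a
    · refine ⟨l, rfl, ?_⟩
      obtain ⟨b, hb⟩ := ha.exists_left_inv
      rw [Ideal.ofList_cons, Ideal.ofList_cons]
      refine le_antisymm (sup_le ?_ le_sup_right) (sup_le ?_ le_sup_right)
      · rw [Ideal.span_singleton_le_iff_mem]
        exact Submodule.add_mem_sup hay hz
      · rw [Ideal.span_singleton_le_iff_mem]
        have h1 : b * (a * y + z) + -b * z = y := by linear_combination y * hb
        have h2 := Submodule.add_mem_sup
          (Ideal.mul_mem_left _ b (Ideal.mem_span_singleton_self (a * y + z)))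
          (Ideal.mul_mem_left _ (-b) hz)
        rwa [h1] at h2
    · have hay2 : a * y ∈ maximalIdeal R * maximalIdeal R := Ideal.mul_mem_mul ha hy
      obtain ⟨l', hlen, h⟩ := ih hl' z hz fun h => hx2 (add_mem hay2 h)
      refine ⟨y :: l', by rw [List.length_cons, List.length_cons, hlen], ?_⟩
      rw [Ideal.ofList_cons, Ideal.ofList_cons, Ideal.ofList_cons, ← h, Ideal.ofList_cons]
      refine le_antisymm (sup_le ?_ (sup_le le_sup_left (le_sup_right.trans le_sup_right)))
        (sup_le (le_sup_left.trans le_sup_right) (sup_le ?_ (le_sup_right.trans le_sup_right)))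
      · rw [Ideal.span_singleton_le_iff_mem]
        exact Submodule.add_mem_sup hay (Ideal.mem_sup_left (Ideal.mem_span_singleton_self _))
      · rw [Ideal.span_singleton_le_iff_mem]
        have h1 := Submodule.add_mem_sup (Ideal.mem_span_singleton_self (a * y + z))
          (Ideal.mem_sup_left (T := Ideal.ofList l') (neg_mem hay))
        rwa [add_neg_cancel_comm] at h1

theorem isLocalRing_quotient_span {R : Type*} [CommRing R] [IsLocalRing R] {x : R}
    (hx : x ∈ maximalIdeal R) : IsLocalRing (R ⧸ Ideal.span {x}) := by
  have : Nontrivial (R ⧸ Ideal.span {x}) := Ideal.Quotient.nontrivial_iff.2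
    (ne_top_of_le_ne_top (maximalIdeal.isMaximal R).ne_top
      ((Ideal.span_singleton_le_iff_mem _).2 hx))
  exact IsLocalRing.of_surjective' _ Ideal.Quotient.mk_surjective

theorem ofList_map_mk_eq_maximalIdeal {R : Type*} [CommRing R] [IsLocalRing R] {x : R}
    [IsLocalRing (R ⧸ Ideal.span {x})] {l : List R}
    (hl : Ideal.ofList (x :: l) = maximalIdeal R) :
    Ideal.ofList (l.map (Ideal.Quotient.mk (Ideal.span {x}))) = maximalIdeal _ := by
  rw [← map_maximalIdeal_of_surjective _ (Ideal.Quotient.mk_surjective (I := Ideal.span {x})),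
    ← hl, Ideal.ofList_cons, Ideal.map_sup, Ideal.map_quotient_self, bot_sup_eq, Ideal.map_ofList]

/-- If `R` is a regular local ring and `x ∈ m \ m²`, then `R/x` is a regular local ring. -/
theorem exists_ofList_quotient {R : Type*} [CommRing R] [IsLocalRing R] [IsNoetherianRing R]
    (d : ℕ) (l : List R) (hd : l.length = d + 1) (hl : Ideal.ofList l = maximalIdeal R)
    (hdim : ((d + 1 : ℕ) : WithBot ℕ∞) ≤ ringKrullDim R) {x : R} (hx : x ∈ maximalIdeal R)
    (hx2 : x ∉ maximalIdeal R * maximalIdeal R) [IsLocalRing (R ⧸ Ideal.span {x})] :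
    ∃ l' : List (R ⧸ Ideal.span {x}), l'.length = d ∧ Ideal.ofList l' = maximalIdeal _ ∧
      ((d : ℕ) : WithBot ℕ∞) ≤ ringKrullDim (R ⧸ Ideal.span {x}) := by
  obtain ⟨l', hlen, hl'⟩ := exists_ofList_cons_eq l hl.le x (hl ▸ hx) hx2
  refine ⟨l'.map (Ideal.Quotient.mk _), by rw [List.length_map]; omega,
    ofList_map_mk_eq_maximalIdeal (hl'.trans hl), ?_⟩
  have h1 := hdim.trans (maximalIdeal_height_eq_ringKrullDim (R := R)).ge
  have h2 := h1.trans (Ideal.height_le_ringKrullDim_quotient_add_one hx)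
  rw [Nat.cast_add, Nat.cast_one] at h2
  exact (ENat.WithBot.add_le_add_one_right_iff).1 h2

theorem maximalIdeal_not_le_of_mem_minimalPrimes {R : Type*} [CommRing R] [IsLocalRing R] (d : ℕ)
    (hdim : ((d + 1 : ℕ) : WithBot ℕ∞) ≤ ringKrullDim R) {q : Ideal R} (hq : q ∈ minimalPrimes R) :
    ¬ maximalIdeal R ≤ q := by
  intro h
  have h1 : maximalIdeal R = q := le_antisymm h (le_maximalIdeal hq.1.1.ne_top)
  rw [← maximalIdeal_height_eq_ringKrullDim, Ideal.height_eq_zero_iff.2 (h1 ▸ hq)] at hdim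
  have h2 : ((d + 1 : ℕ) : WithBot ℕ∞) ≤ ((0 : ℕ) : WithBot ℕ∞) := hdim
  exact absurd (Nat.cast_le.1 h2) (by omega)

theorem maximalIdeal_not_le_mul_self {R : Type*} [CommRing R] [IsLocalRing R] [IsNoetherianRing R]
    (d : ℕ) (hdim : ((d + 1 : ℕ) : WithBot ℕ∞) ≤ ringKrullDim R) :
    ¬ maximalIdeal R ≤ maximalIdeal R * maximalIdeal R := by
  intro h
  have h1 : maximalIdeal R = ⊥ := Submodule.eq_bot_of_le_smul_of_le_jacobson_bot (maximalIdeal R) _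
    (IsNoetherian.noetherian _) h (maximalIdeal_le_jacobson _)
  obtain ⟨q, hq⟩ := Ideal.nonempty_minimalPrimes (I := (⊥ : Ideal R)) bot_ne_top
  exact maximalIdeal_not_le_of_mem_minimalPrimes d hdim hq (h1 ▸ bot_le)

/-- Prime avoidance yields `x ∈ m` outside `m²` and outside all minimal primes. By induction `R/x`
is a domain, so `(x)` is prime and contains a minimal prime `q`. -/
theorem isDomain_of_ofList_eq_maximalIdeal (d : ℕ) (R : Type u) [CommRing R] [IsLocalRing R]
    [IsNoetherianRing R] (l : List R) (hd : l.length = d) (hl : Ideal.ofList l = maximalIdeal R)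
    (hdim : ((d : ℕ) : WithBot ℕ∞) ≤ ringKrullDim R) : IsDomain R := by
  induction d generalizing R with
  | zero =>
    rw [List.length_eq_zero_iff] at hd
    rw [hd, Ideal.ofList_nil] at hl
    exact (isField_iff_maximalIdeal_eq.2 hl.symm).isDomain
  | succ d ih =>
    obtain ⟨x, hx, hx2, hxq⟩ : ∃ x ∈ maximalIdeal R, x ∉ maximalIdeal R * maximalIdeal R ∧
        ∀ q ∈ minimalPrimes R, x ∉ q := by
      by_contra! hcon
      have hfin := minimalPrimes.finite_of_isNoetherianRing R
      have h1 : (maximalIdeal R : Set R) ⊆ ⋃ I ∈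
          (↑(insert (maximalIdeal R * maximalIdeal R) hfin.toFinset) : Set (Ideal R)),
            (I : Set R) := by
        intro x hx
        by_cases hx2 : x ∈ maximalIdeal R * maximalIdeal R
        · exact Set.mem_biUnion (Finset.mem_coe.2 (Finset.mem_insert_self _ _)) hx2
        · obtain ⟨q, hq, hxq⟩ := hcon x hx hx2
          exact Set.mem_biUnion (Finset.mem_coe.2 (Finset.mem_insert_of_mem
            (hfin.mem_toFinset.2 hq))) hxq
      obtain ⟨I, hI, h2⟩ := (Ideal.subset_union_prime (f := id)
        (maximalIdeal R * maximalIdeal R) (maximalIdeal R * maximalIdeal R)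
        (fun I hI h _ => (hfin.mem_toFinset.1 ((Finset.mem_insert.1 hI).resolve_left h)).1.1)).1 h1
      rcases Finset.mem_insert.1 hI with rfl | hI
      · exact maximalIdeal_not_le_mul_self d hdim h2
      · exact maximalIdeal_not_le_of_mem_minimalPrimes d hdim (hfin.mem_toFinset.1 hI) h2
    have := isLocalRing_quotient_span hx
    obtain ⟨l', hd', hl', hdim'⟩ := exists_ofList_quotient d l hd hl hdim hx hx2
    have h1 := ih _ l' hd' hl' hdim'
    have h2 : (Ideal.span {x}).IsPrime := (Ideal.Quotient.isDomain_iff_prime _).1 h1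
    obtain ⟨q, hq, hqx⟩ := Ideal.exists_minimalPrimes_le (bot_le : ⊥ ≤ Ideal.span {x})
    have := hq.1.1
    -- Each element of `q` is `ax` with `a ∈ q`, because `x ∉ q`; so `q ⊆ mq` and Nakayama applies.
    have h3 : q = ⊥ := by
      refine Submodule.eq_bot_of_le_smul_of_le_jacobson_bot (maximalIdeal R) _
        (IsNoetherian.noetherian _) (fun y hy => ?_) (maximalIdeal_le_jacobson _)
      obtain ⟨a, rfl⟩ := Ideal.mem_span_singleton'.1 (hqx hy)
      rw [mul_comm]
      exact Ideal.mul_mem_mul hx ((hq.1.1.mem_or_mem hy).resolve_right (hxq q hq))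
    have : (⊥ : Ideal R).IsPrime := h3 ▸ hq.1.1
    exact IsDomain.of_bot_isPrime R

theorem exists_cons_isWeaklyRegular {R : Type*} [CommRing R] [IsLocalRing R] {x : R}
    (hx : x ∈ maximalIdeal R) (hreg : IsSMulRegular R x) [IsLocalRing (R ⧸ Ideal.span {x})]
    (h : ∃ l : List (R ⧸ Ideal.span {x}), IsWeaklyRegular (R ⧸ Ideal.span {x}) l ∧
      Ideal.ofList l = maximalIdeal _) :
    ∃ l : List R, IsWeaklyRegular R (x :: l) ∧ Ideal.ofList (x :: l) = maximalIdeal R := by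
  obtain ⟨l, hl, hl'⟩ := h
  obtain ⟨l, rfl⟩ := List.map_surjective_iff.2
    (Ideal.Quotient.mk_surjective (I := Ideal.span {x})) l
  refine ⟨l, .cons hreg ?_, ?_⟩
  · have e : QuotSMulTop x R ≃ₗ[R] R ⧸ Ideal.span {x} := Submodule.quotEquivOfEq _ _ (by
      rw [← Submodule.ideal_span_singleton_smul, smul_eq_mul, Ideal.mul_top])
    rw [e.isWeaklyRegular_congr]
    exact (isWeaklyRegular_map_algebraMap_iff (R ⧸ Ideal.span {x}) _ l).1 hl
  · have h1 := congrArg (Ideal.comap (Ideal.Quotient.mk (Ideal.span {x}))) hl'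
    rw [← Ideal.map_ofList, Ideal.comap_map_of_surjective _ Ideal.Quotient.mk_surjective,
      ← map_maximalIdeal_of_surjective _ (Ideal.Quotient.mk_surjective (I := Ideal.span {x})),
      Ideal.comap_map_of_surjective _ Ideal.Quotient.mk_surjective, ← RingHom.ker_eq_comap_bot,
      Ideal.mk_ker, sup_eq_left.2 ((Ideal.span_singleton_le_iff_mem _).2 hx), sup_comm] at h1
    rw [Ideal.ofList_cons, h1]

/-- The maximal ideal of a regular local ring is generated by a regular sequence. -/
theorem exists_isWeaklyRegular (d : ℕ) (R : Type u) [CommRing R] [IsLocalRing R]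
    [IsNoetherianRing R] (l : List R) (hd : l.length = d) (hl : Ideal.ofList l = maximalIdeal R)
    (hdim : ((d : ℕ) : WithBot ℕ∞) ≤ ringKrullDim R) :
    ∃ rs : List R, IsWeaklyRegular R rs ∧ Ideal.ofList rs = maximalIdeal R := by
  induction d generalizing R with
  | zero =>
    rw [List.length_eq_zero_iff] at hd
    subst hd
    exact ⟨[], .nil R R, hl⟩
  | succ d ih =>
    obtain ⟨x, hx, hx2⟩ := SetLike.not_le_iff_exists.1 (maximalIdeal_not_le_mul_self d hdim)
    have := isLocalRing_quotient_span hx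
    obtain ⟨l', hd', hl', hdim'⟩ := exists_ofList_quotient d l hd hl hdim hx hx2
    have := isDomain_of_ofList_eq_maximalIdeal (d + 1) R l hd hl hdim
    have hx0 : x ≠ 0 := fun h => hx2 (h ▸ zero_mem _)
    obtain ⟨rs, h⟩ := exists_cons_isWeaklyRegular hx
      (fun a b hab => mul_left_cancel₀ hx0 hab) (ih _ l' hd' hl' hdim')
    exact ⟨_, h⟩

/-- Over a local ring, regular sequences in `m` on Noetherian modules may be permuted. An entry is
moved to the end, where raising it to a power is harmless, and then joins `l₁`. -/
theorem IsWeaklyRegular.append_map_pow {R M : Type*} [CommRing R] [IsLocalRing R]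
    [AddCommGroup M] [Module R M] [IsNoetherian R M] {k : ℕ} (hk : k ≠ 0) (l₁ l₂ : List R)
    (h : IsWeaklyRegular M (l₁ ++ l₂)) (hm : ∀ r ∈ l₁ ++ l₂, r ∈ maximalIdeal R) :
    IsWeaklyRegular M (l₁ ++ l₂.map (· ^ k)) := by
  induction l₂ generalizing l₁ with
  | nil => simpa using h
  | cons x l₂ ih =>
    have hp1 : (l₁ ++ x :: l₂).Perm (l₁ ++ l₂ ++ [x]) := by
      rw [List.append_assoc]
      exact List.Perm.append_left _ (List.perm_append_comm (l₁ := [x]))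
    have hp2 : (l₁ ++ l₂ ++ [x ^ k]).Perm (l₁ ++ [x ^ k] ++ l₂) := by
      rw [List.append_assoc, List.append_assoc]
      exact List.Perm.append_left _ List.perm_append_comm
    have hm1 : ∀ r ∈ l₁ ++ l₂ ++ [x ^ k], r ∈ maximalIdeal R := by
      intro r hr
      rcases List.mem_append.1 hr with hr | hr
      · exact hm r (by
          rcases List.mem_append.1 hr with hr | hr
          · exact List.mem_append_left _ hr
          · exact List.mem_append_right _ (List.mem_cons_of_mem _ hr))
      · rw [List.mem_singleton.1 hr]
        exact Ideal.pow_mem_of_mem _ (hm x (List.mem_append_right _ List.mem_cons_self)) k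
          (Nat.pos_of_ne_zero hk)
    have h1 := isWeaklyRegular_of_perm_of_subset_maximalIdeal h hp1 hm
    rw [isWeaklyRegular_append_iff, isWeaklyRegular_singleton_iff] at h1
    have h2 : IsWeaklyRegular M (l₁ ++ l₂ ++ [x ^ k]) := by
      rw [isWeaklyRegular_append_iff, isWeaklyRegular_singleton_iff]
      exact ⟨h1.1, h1.2.pow k⟩
    have h3 := ih (l₁ ++ [x ^ k]) (isWeaklyRegular_of_perm_of_subset_maximalIdeal h2 hp2 hm1)
      fun r hr => hm1 r (hp2.mem_iff.2 hr)
    simpa using h3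

/-- Induction on the length: the case of a field is clear, and `M` is free once `x` is regular on
`M` and `M/xM` is free over `R/x`. -/
theorem free_of_isWeaklyRegular (n : ℕ) (R : Type u) [CommRing R] [IsLocalRing R]
    [IsNoetherianRing R] (M : Type u) [AddCommGroup M] [Module R M] [Module.Finite R M]
    (rs : List R) (hn : rs.length = n) (hR : IsWeaklyRegular R rs) (hM : IsWeaklyRegular M rs)
    (hrs : Ideal.ofList rs = maximalIdeal R) : Module.Free R M := by
  induction n generalizing R M with
  | zero =>
    rw [List.length_eq_zero_iff] at hn
    rw [hn, Ideal.ofList_nil] at hrs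
    let := (isField_iff_maximalIdeal_eq.2 hrs.symm).toField
    exact Module.Free.of_divisionRing R M
  | succ n ih =>
    obtain ⟨x, rs, rfl⟩ := List.exists_cons_of_length_eq_add_one hn
    have hx : x ∈ maximalIdeal R := hrs ▸ Ideal.subset_span List.mem_cons_self
    have := isLocalRing_quotient_span hx
    rw [isWeaklyRegular_cons_iff'] at hM
    have hR' := (isWeaklyRegular_cons_iff R x rs).1 hR
    have e : QuotSMulTop x R ≃ₗ[R] R ⧸ Ideal.span {x} := Submodule.quotEquivOfEq _ _ (by
      rw [← Submodule.ideal_span_singleton_smul, smul_eq_mul, Ideal.mul_top])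
    have h1 : IsWeaklyRegular (R ⧸ Ideal.span {x}) (rs.map (Ideal.Quotient.mk (Ideal.span {x}))) :=
      (isWeaklyRegular_map_algebraMap_iff (R ⧸ Ideal.span {x}) _ rs).2
        ((e.isWeaklyRegular_congr rs).1 hR'.2)
    have : Module.Finite (R ⧸ Ideal.span {x}) (QuotSMulTop x M) :=
      Module.Finite.of_restrictScalars_finite R _ _
    have h2 := ih (R ⧸ Ideal.span {x}) (QuotSMulTop x M) (rs.map (Ideal.Quotient.mk _))
      (by rw [List.length_map]; simpa using hn) h1 hM.2 (ofList_map_mk_eq_maximalIdeal hrs)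
    have := Module.finitePresentation_of_finite R M
    exact (Module.free_quotSMulTop_iff_free R M (maximalIdeal_le_jacobson _ hx) hM.1).1 h2

end Regular

/-! ### Freeness of `φ_* A`. -/

namespace DualizingData

open IsLocalRing RingTheory.Sequence

variable {p : ℕ} [hp : Fact p.Prime] {A : Type u} [CommRing A] (D : DualizingData p A)

/-- Write `φ(a) = a^p + p δ(a)`. The product and sum rules for `δ` show `δ(m²) ⊆ m`, whereas `φ(p) =
p` gives `δ(p) = 1 - p^{p-1}`, a unit. -/
theorem natCast_notMem_mul_self (D : DualizingData p A) [IsLocalRing A]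
    (h : (p : A) ∈ maximalIdeal A) :
    (p : A) ∉ maximalIdeal A * maximalIdeal A := by
  intro h2
  have hlift (a : A) : ∃ s, D.φ a = a ^ p + p * s := by
    obtain ⟨s, hs⟩ := D.lift a
    exact ⟨s, by rw [← hs]; ring⟩
  have key : ∀ a ∈ maximalIdeal A * maximalIdeal A,
      a ∈ maximalIdeal A ∧ ∃ s ∈ maximalIdeal A, D.φ a = a ^ p + p * s := by
    intro a ha
    refine Submodule.mul_induction_on ha (fun x hx y hy => ?_) fun x y hx hy => ?_
    · refine ⟨Ideal.mul_mem_left _ _ hy, ?_⟩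
      obtain ⟨s, hs⟩ := hlift x
      obtain ⟨t, ht⟩ := hlift y
      refine ⟨x ^ p * t + y ^ p * s + p * (s * t), ?_, by rw [map_mul, hs, ht]; ring⟩
      exact add_mem (add_mem (Ideal.mul_mem_right _ _ (Ideal.pow_mem_of_mem _ hx p hp.out.pos))
        (Ideal.mul_mem_right _ _ (Ideal.pow_mem_of_mem _ hy p hp.out.pos)))
        (Ideal.mul_mem_right _ _ h)
    · obtain ⟨hx, s, hs, hsx⟩ := hx
      obtain ⟨hy, t, ht, hty⟩ := hy
      obtain ⟨r, hr⟩ := exists_add_pow_prime_eq hp.out x y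
      refine ⟨add_mem hx hy, s + t - x * y * r, ?_, by rw [map_add, hsx, hty, hr]; ring⟩
      exact sub_mem (add_mem hs ht) (Ideal.mul_mem_right _ _ (Ideal.mul_mem_right _ _ hx))
  obtain ⟨-, s, hs, h3⟩ := key p h2
  rw [map_natCast] at h3
  obtain ⟨k, hk⟩ := Nat.exists_eq_add_of_le' hp.out.two_le
  have h4 : (1 : A) - (p ^ (k + 1) + s) = 0 := by
    apply D.torsionFree
    have : (p : A) ^ p = p * p ^ (k + 1) := by rw [← pow_succ']; congr 1
    rw [this] at h3
    linear_combination h3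
  exact (maximalIdeal.isMaximal A).ne_top ((Ideal.eq_top_iff_one _).2 (sub_eq_zero.1 h4 ▸
    add_mem (Ideal.pow_mem_of_mem _ h _ k.succ_pos) hs))

/-- Since `p ∈ m \ m²`, a regular sequence `p, x_2, …, x_d` generates `m`. It acts on `φ_* A` as `p,
φ(x_2), …, φ(x_d)`, which modulo `p` is `x_2^p, …, x_d^p`, hence is regular. -/
theorem free_phiMod [IsRegularLocalRing A] (h : (p : A) ∈ maximalIdeal A) :
    Module.Free A D.PhiMod := by
  have hdim := IsRegularLocalRing.spanFinrank_maximalIdeal (R := A)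
  obtain ⟨l, hlen, hl⟩ : ∃ l : List A, l.length = (maximalIdeal A).spanFinrank ∧
      Ideal.ofList l = maximalIdeal A := by
    have hfg : (maximalIdeal A).FG := IsNoetherian.noetherian _
    have hfin := Submodule.FG.finite_generators hfg
    refine ⟨hfin.toFinset.toList, ?_, ?_⟩
    · rw [Finset.length_toList, ← Set.ncard_eq_toFinset_card _ hfin]
      exact Submodule.FG.generators_ncard hfg
    · rw [Ideal.ofList]
      simpa using! Submodule.span_generators (maximalIdeal A)
  have hp2 := D.natCast_notMem_mul_self h
  obtain ⟨d, hd⟩ : ∃ d, l.length = d + 1 := by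
    refine Nat.exists_eq_succ_of_ne_zero fun h0 => ?_
    rw [List.length_eq_zero_iff.1 h0, Ideal.ofList_nil] at hl
    rw [← hl, Ideal.mem_bot] at h
    exact hp2 (h ▸ zero_mem _)
  have hloc := isLocalRing_quotient_span h
  obtain ⟨l', hd', hl', hdim'⟩ := exists_ofList_quotient d l hd hl
    (by rw [← hdim, ← hlen, hd]) h hp2
  have hreg : IsSMulRegular A (p : A) := fun a b hab => D.pow_mul_cancel 1 (by
    rw [pow_one]; exact hab)
  obtain ⟨rs, hrs, hm⟩ := exists_cons_isWeaklyRegular h hreg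
    (exists_isWeaklyRegular d _ l' hd' hl' hdim')
  have : Module.Finite A D.PhiMod := D.finite
  refine free_of_isWeaklyRegular _ A D.PhiMod (p :: rs) rfl hrs ?_ hm
  have h1 : IsWeaklyRegular A ([(p : A)] ++ rs.map (· ^ p)) :=
    IsWeaklyRegular.append_map_pow hp.out.ne_zero [(p : A)] rs hrs fun r hr =>
      hm ▸ Ideal.subset_span hr
  have h2 : (rs.map D.φ).map (Ideal.Quotient.mk (Ideal.span {(p : A)}))
      = (rs.map (· ^ p)).map (Ideal.Quotient.mk (Ideal.span {(p : A)})) := by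
    rw [List.map_map, List.map_map]
    refine List.map_congr_left fun r _ => ?_
    exact Ideal.Quotient.eq.2 (Ideal.mem_span_singleton.2 (D.lift r))
  have h3 : IsWeaklyRegular A ((p : A) :: rs.map D.φ) := by
    rw [isWeaklyRegular_cons_iff', h2, ← isWeaklyRegular_cons_iff']
    exact h1
  rw [← isWeaklyRegular_map_algebraMap_iff D.PhiMod, List.map_cons, map_natCast]
  exact h3

/-- Duality modulo `p` for the finite map `φ`. -/
theorem exists_trA_eq [IsRegularLocalRing A] (h : A →+ Ap p A 1)
    (hh : ∀ a b, h (D.φ a * b) = a • h b) :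
    ∃ g, ∀ b, h b = Ideal.Quotient.mk _ (D.trA (b * g)) := by
  by_cases hpm : (p : A) ∈ maximalIdeal A
  · have := D.free_phiMod hpm
    exact D.exists_trA_eq_of_free h hh
  · have h1 : Subsingleton (Ap p A 1) := Ideal.Quotient.subsingleton_iff.2
      (Ideal.span_singleton_eq_top.2 ((notMem_maximalIdeal.1 hpm).pow 1))
    exact ⟨0, fun b => Subsingleton.elim _ _⟩

theorem exists_dvd_trA_sub [IsRegularLocalRing A] (a : A) : ∃ b, (p : A) ^ 1 ∣ D.trA b - a := by
  by_cases hpm : (p : A) ∈ maximalIdeal A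
  · have := D.free_phiMod hpm
    obtain ⟨b, hb⟩ := D.trA_surjective_of_free a
    exact ⟨b, by rw [hb, sub_self]; exact dvd_zero _⟩
  · exact ⟨0, ((notMem_maximalIdeal.1 hpm).pow 1).dvd⟩

end DualizingData

/-! ### Congruences between ghost components, and the assertions on `Ψ`. -/

namespace DualizingData

variable {p : ℕ} [hp : Fact p.Prime] {A : Type u} [CommRing A] (D : DualizingData p A)

theorem mk_eq_mk_iff {n : ℕ} {a b : A} :
    (Ideal.Quotient.mk _ a : Ap p A n) = Ideal.Quotient.mk _ b ↔ (p : A) ^ n ∣ a - b := by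
  rw [Ideal.Quotient.eq, Ideal.mem_span_singleton]

theorem pow_dvd_trA_iterate (k : ℕ) {n : ℕ} {a : A} (h : (p : A) ^ n ∣ a) :
    (p : A) ^ n ∣ D.trA^[k] a := by
  induction k generalizing a with
  | zero => exact h
  | succ k ih => exact ih (D.pow_dvd_trA h)

theorem trA_iterate_pow_mul (k n : ℕ) (a : A) :
    D.trA^[k] ((p : A) ^ n * a) = (p : A) ^ n * D.trA^[k] a := by
  induction k generalizing a with
  | zero => rfl
  | succ k ih => rw [Function.iterate_succ_apply, trA_pow_mul, ih]; rfl

theorem pow_dvd_trA_iterate_sub (k : ℕ) {n : ℕ} {a b : A} (h : (p : A) ^ n ∣ a - b) :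
    (p : A) ^ n ∣ D.trA^[k] a - D.trA^[k] b := by
  rw [← iterate_map_sub]
  exact D.pow_dvd_trA_iterate k h

/-- The Dwork congruence. The summands are compared one by one: `φ(y_i)^{p^k} ≡ y_i^{p^{k+1}}` mod
`p^{k+1}` with `k = n - i`, and the factor `p^i` supplies the rest. The additional summand is
divisible by `p^{n+1}`. -/
theorem dvd_ghostComponent_succ_sub (n : ℕ) (y : WittVector p A) :
    (p : A) ^ (n + 1) ∣ WittVector.ghostComponent (n + 1) y
      - D.φ (WittVector.ghostComponent n y) := by
  rw [ghost_eq, ghost_eq, Finset.sum_range_succ, map_sum, add_sub_right_comm,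
    ← Finset.sum_sub_distrib]
  refine dvd_add (Finset.dvd_sum fun i hi => ?_) (dvd_mul_right _ _)
  obtain ⟨k, rfl⟩ := Nat.exists_eq_add_of_le (Nat.lt_succ_iff.1 (Finset.mem_range.1 hi))
  rw [map_mul, map_pow, map_natCast, map_pow, ← mul_sub, add_assoc, Nat.add_sub_cancel_left,
    Nat.add_sub_cancel_left, pow_add]
  refine mul_dvd_mul_left _ ?_
  rw [dvd_sub_comm]
  exact D.dvd_phi_pow _ _

theorem dvd_ghostComponent_sub (n : ℕ) (y : WittVector p A) :
    (p : A) ^ 1 ∣ WittVector.ghostComponent n y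
      - (D.φ ^ n) (WittVector.ghostComponent 0 y) := by
  induction n with
  | zero => simp
  | succ n ih =>
    rw [pow_succ_apply]
    have h1 : (p : A) ^ 1 ∣ D.φ (WittVector.ghostComponent n y
        - (D.φ ^ n) (WittVector.ghostComponent 0 y)) := by
      obtain ⟨c, hc⟩ := ih
      rw [hc, map_mul, map_pow, map_natCast]
      exact dvd_mul_right _ _
    have h2 := (pow_dvd_pow (p : A) (Nat.succ_le_succ n.zero_le)).trans
      (D.dvd_ghostComponent_succ_sub n y)
    have h3 := dvd_add h2 h1
    rwa [map_sub, sub_add_sub_cancel] at h3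

/-! ### Linearity and multiplicativity of `Ψ` -/

theorem Psi_add (e n : ℕ) (hn : 1 ≤ n) (g g' : Ap p A n) :
    D.Psi e n (g + g') = D.Psi e n g + D.Psi e n g' := by
  refine Dual.ev_ext fun α x => ?_
  rw [Dual.add_app, ev_add, ev_Psi _ _ _ hn, ev_Psi _ _ _ hn, ev_Psi _ _ _ hn, add_mul, map_add,
    iterate_map_add]

theorem Psi_smul (e n : ℕ) (hn : 1 ≤ n) (a : A) (g : Ap p A n) :
    D.Psi e n ((D.φ ^ (e + n - 1)) a • g) = a • D.Psi e n g := by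
  refine Dual.ev_ext fun α x => ?_
  rw [Dual.smul_app', ev_smul, ev_sW_mul, ev_Psi _ _ _ hn, ev_Psi _ _ _ hn, smul_mul_assoc,
    map_smul, D.iterate_smul _ D.trQ_smul]

theorem Psi_mul_pow (e n : ℕ) (hn : 1 ≤ n) (f g : Ap p A n) :
    D.Psi e n (g * f ^ p ^ (e + n - 1)) = teich n (redP p A hn f) • D.Psi e n g := by
  obtain ⟨f, rfl⟩ := Ideal.Quotient.mk_surjective f
  refine Dual.ev_ext fun α x => ?_
  have h1 : redP p A hn (Ideal.Quotient.mk _ f) = Ideal.Quotient.mk _ f := rfl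
  have h2 : ghost n (α * (D.F n ^ e) (teich n (Ideal.Quotient.mk _ f) * x))
      = Ideal.Quotient.mk _ f ^ p ^ (e + n - 1) * ghost n (α * (D.F n ^ e) x) := by
    rw [map_mul (D.F n ^ e), F_pow_teich, ← map_pow, mul_left_comm α, map_mul (ghost n),
      ghost_teich, ← pow_mul, ← pow_add, Nat.add_sub_assoc hn, map_pow]
  rw [h1, Dual.smul_app, ev_smul, ev_Psi _ _ _ hn, ev_Psi _ _ _ hn, h2, mul_assoc]

/-! ### The relation with the restriction maps -/

theorem ev_resDual {e m n : ℕ} (h : m ≤ n) (ψ : D.Dual e m) (α x : W p A n) :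
    D.ev ((D.resDual e h ψ).app α) x = D.ev (ψ.app (res h α)) (res h x) :=
  D.ev_T h _ x

/-- The factor `p` cancels against `p^{n+1}`. Modulo `p^n` the ghost component `w_n` is
`φ(w_{n-1})`, and one of the traces absorbs this `φ` and turns `g` into `trA(g)`. -/
theorem Psi_p_mul (e n : ℕ) (hn : 1 ≤ n) (g : Ap p A (n + 1)) :
    D.Psi e (n + 1) (p * g)
      = D.resDual e n.le_succ (D.Psi e n (red p A n.le_succ (D.u (n + 1) g))) := by
  obtain ⟨g, rfl⟩ := Ideal.Quotient.mk_surjective g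
  refine Dual.ev_ext fun α x => ?_
  obtain ⟨y, hy⟩ := proj_surjective (n + 1) (α * (D.F (n + 1) ^ e) x)
  have h1 : red p A n.le_succ (D.u (n + 1) (Ideal.Quotient.mk _ g))
      = Ideal.Quotient.mk _ (D.trA g) := by rw [u_mk]; rfl
  have h2 : proj p A n y = res n.le_succ α * (D.F n ^ e) (res n.le_succ x) := by
    rw [← res_F_pow, ← map_mul, ← hy, res_proj]
  rw [ev_resDual, h1, D.ev_Psi_mk e n hn _ _ _ y h2, ← map_natCast (Ideal.Quotient.mk _) p,
    ← map_mul, D.ev_Psi_mk e (n + 1) n.succ_pos _ _ _ y hy]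
  have h3 := frac_pow_mul (p := p) 1 n (D.trA^[e + (n + 1) - 1] (g * WittVector.ghostComponent n y))
  rw [← trA_iterate_pow_mul, pow_one, ← mul_assoc, Nat.add_comm 1 n] at h3
  refine h3.trans (congrArg _ (mk_eq_mk_iff.2 ?_))
  obtain ⟨n, rfl⟩ := Nat.exists_eq_add_of_le' hn
  rw [show e + (n + 1 + 1) - 1 = e + (n + 1) - 1 + 1 by omega, Function.iterate_succ_apply,
    mul_comm (D.trA g), ← trA_mul, Nat.add_sub_cancel]
  refine D.pow_dvd_trA_iterate_sub _ ?_
  rw [← map_sub]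
  refine D.pow_dvd_trA ?_
  rw [mul_comm, ← sub_mul]
  exact Dvd.dvd.mul_right (D.dvd_ghostComponent_succ_sub n y) _

/-- As `p^n a/p^{n+1} = a/p`, only `w_n ≡ φ^n(w_0)` mod `p` matters, and `n` of the traces absorb
`φ^n`. -/
theorem Psi_mulPow (e n : ℕ) (a : Ap p A 1) :
    D.Psi e (n + 1) (mulPow p A n a)
      = D.resDual e (Nat.succ_le_succ n.zero_le) (D.Psi e 1 ((D.u 1)^[n] a)) := by
  obtain ⟨a, rfl⟩ := Ideal.Quotient.mk_surjective a
  refine Dual.ev_ext fun α x => ?_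
  obtain ⟨y, hy⟩ := proj_surjective (n + 1) (α * (D.F (n + 1) ^ e) x)
  have h2 : proj p A 1 y = res (Nat.succ_le_succ n.zero_le) α
      * (D.F 1 ^ e) (res (Nat.succ_le_succ n.zero_le) x) := by
    rw [← res_F_pow, ← map_mul, ← hy, res_proj]
  have h1 : mulPow p A n (Ideal.Quotient.mk _ a) = Ideal.Quotient.mk _ ((p : A) ^ n * a) := rfl
  rw [ev_resDual, h1, u_iterate_mk, D.ev_Psi_mk e 1 le_rfl _ _ _ y h2,
    D.ev_Psi_mk e (n + 1) n.succ_pos _ _ _ y hy, mul_assoc, trA_iterate_pow_mul, frac_pow_mul]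
  refine congrArg _ (mk_eq_mk_iff.2 ?_)
  rw [show e + (n + 1) - 1 = e + n by omega, Function.iterate_add_apply,
    mul_comm (D.trA^[n] a), Nat.add_sub_cancel, ← trA_iterate_mul]
  refine D.pow_dvd_trA_iterate_sub _ (D.pow_dvd_trA_iterate_sub _ ?_)
  rw [mul_comm, ← sub_mul]
  exact Dvd.dvd.mul_right (D.dvd_ghostComponent_sub n y) _

theorem resDual_injective (e : ℕ) {m n : ℕ} (h : m ≤ n) : Function.Injective (D.resDual e h) := by
  intro ψ χ hψ
  refine Dual.ev_ext fun α x => ?_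
  obtain ⟨α, rfl⟩ := res_surjective h α
  obtain ⟨x, rfl⟩ := res_surjective h x
  rw [← ev_resDual, hψ, ev_resDual]

/-- In terms of functionals `T` is precomposition with the surjection `Res`, so its image consists
of the functionals that vanish on the kernel of `Res`. -/
theorem exists_T_eq {m n : ℕ} (h : m ≤ n) (w : D.Wω n)
    (hw : ∀ z, res h z = 0 → D.ev w z = 0) : ∃ v, D.T h v = w := by
  have hs : Function.Surjective (res (p := p) (A := A) h).toAddMonoidHom := res_surjective h
  have hk : (res (p := p) (A := A) h).toAddMonoidHom.ker ≤ (D.ev w).ker := fun z hz => hw z hz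
  let f := (res (p := p) (A := A) h).toAddMonoidHom.liftOfSurjective hs ⟨D.ev w, hk⟩
  have hf (x : W p A n) : f (res h x) = D.ev w x :=
    AddMonoidHom.liftOfRightInverse_comp_apply _ _ (Function.rightInverse_surjInv hs)
      ⟨D.ev w, hk⟩ x
  obtain ⟨v, hv⟩ := D.exists_ev f fun a x => by
    obtain ⟨x, rfl⟩ := res_surjective h x
    rw [← res_sW D h, ← map_mul, hf, hf, ev_sW_mul]
  exact ⟨v, D.ev_ext fun x => by rw [ev_T, hv, hf]⟩

/-! ### The dual of `V` -/

theorem Dual.app_zero {D : DualizingData p A} {e n : ℕ} (ψ : D.Dual e n) : ψ.app 0 = 0 := by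
  have := ψ.app_add 0 0
  rwa [add_zero, left_eq_add] at this

theorem Dual.zero_app {D : DualizingData p A} {e n : ℕ} (α : W p A n) :
    (0 : D.Dual e n).app α = 0 := rfl

theorem exists_T_eq_app_ver {e n : ℕ} (ψ : D.Dual e (n + 1)) (α : W p A n) :
    ∃ v, D.T n.le_succ v = ψ.app (ver n α) := by
  refine D.exists_T_eq _ _ fun z hz => ?_
  -- By the projection formula the product depends on `z` only through `Res z`.
  have h1 : (D.F (n + 1) ^ e) z * ver n α = 0 := by
    rw [mul_comm, ver_mul D, res_F_pow, hz, map_zero, map_zero, mul_zero, map_zero]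
  rw [Dual.ev_app, h1, Dual.app_zero, ev_zero]

theorem existsUnique_verDual (e n : ℕ) :
    ∃! Vd : D.Dual e (n + 1) →ₗ[A] D.Dual (e + 1) n, D.IsVerDual e n Vd := by
  choose v hv using fun ψ : D.Dual e (n + 1) => D.exists_T_eq_app_ver (n := n) ψ
  suffices h : ∃ Vd : D.Dual e (n + 1) →ₗ[A] D.Dual (e + 1) n, D.IsVerDual e n Vd by
    obtain ⟨Vd, hVd⟩ := h
    refine ⟨Vd, hVd, fun Vd' h => LinearMap.ext fun ψ => Dual.ext fun α =>
      D.T_injective n.le_succ ?_⟩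
    rw [h, hVd]
  refine ⟨{ toFun := fun ψ => Dual.mk (v ψ) (fun α β => ?_) fun β α => ?_
            map_add' := fun ψ χ => Dual.ext fun α => ?_
            map_smul' := fun a ψ => Dual.ext fun α => ?_ }, fun ψ α => ?_⟩
  · apply D.T_injective n.le_succ
    rw [map_add, hv, hv, hv, map_add, Dual.app_add]
  · apply D.T_injective n.le_succ
    obtain ⟨β, rfl⟩ := res_surjective n.le_succ β
    rw [hv, T_smul, hv, F_pow_succ_apply, ← res_F_pow, mul_comm, ← ver_mul, mul_comm,
      Dual.app_smul]
  · apply D.T_injective n.le_succ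
    rw [Dual.add_app, Dual.app_mk, Dual.app_mk, Dual.app_mk, map_add, hv, hv, hv, Dual.add_app]
  · apply D.T_injective n.le_succ
    rw [RingHom.id_apply, Dual.smul_app', Dual.app_mk, Dual.app_mk, ← res_sW D n.le_succ, T_smul,
      hv, hv, Dual.smul_app']
  · exact hv ψ α

/-- If `ψ ∘ V = 0`, then `ψ(α)` depends only on `α` modulo the image of `V`, that is, on `Res α`.
Moreover `ψ(α)(V y) = ψ(V(F^e y) α)(1)` vanishes by the projection formula, so `ψ(α)` lies in the
image of `T`. Hence `ψ` descends in both source and target. -/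
theorem exact_resDual_verDual (e n : ℕ) (Vd : D.Dual e (n + 1) →ₗ[A] D.Dual (e + 1) n)
    (hVd : D.IsVerDual e n Vd) :
    Function.Exact (D.resDual e (Nat.succ_le_succ n.zero_le)) Vd := by
  intro ψ
  constructor
  · intro h0
    have h1 (α : W p A n) : ψ.app (ver n α) = 0 := by
      rw [← hVd, h0, Dual.zero_app, map_zero]
    have h2 (α z : W p A (n + 1)) (hz : res (Nat.succ_le_succ n.zero_le) z = (0 : W p A 1)) :
        D.ev (ψ.app α) z = 0 := by
      obtain ⟨y, rfl⟩ := exists_ver_of_res_eq_zero n z hz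
      rw [Dual.ev_app, F_pow_ver, ver_mul D, h1, ev_zero]
    choose v hv using fun α => D.exists_T_eq (Nat.succ_le_succ n.zero_le) (ψ.app α) (h2 α)
    have h3 (α β : W p A (n + 1)) (h : (res (Nat.succ_le_succ n.zero_le) α : W p A 1)
        = res (Nat.succ_le_succ n.zero_le) β) : v α = v β := by
      apply D.T_injective (Nat.succ_le_succ n.zero_le)
      obtain ⟨y, hy⟩ := exists_ver_of_res_eq_zero n (α - β) (by rw [map_sub, h, sub_self])
      rw [hv, hv, ← sub_add_cancel α β, hy, Dual.app_add, h1, zero_add]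
    have hs := res_surjective (p := p) (A := A) (Nat.succ_le_succ n.zero_le)
    let r := Function.surjInv hs
    have hr := Function.surjInv_eq hs
    refine ⟨Dual.mk (fun α => v (r α)) (fun α β => ?_) (fun β α => ?_), Dual.ext fun α => ?_⟩
    · apply D.T_injective (Nat.succ_le_succ n.zero_le)
      rw [map_add, hv (r α), hv (r β), ← Dual.app_add, ← hv]
      exact congrArg _ (h3 _ _ (by rw [map_add, hr, hr, hr]))
    · apply D.T_injective (Nat.succ_le_succ n.zero_le)
      obtain ⟨β, rfl⟩ := hs β
      rw [T_smul, hv (r α), ← Dual.app_smul, ← hv]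
      exact congrArg _ (h3 _ _ (by rw [map_mul, hr, hr, res_F_pow]))
    · change D.T _ (v (r (res _ α))) = ψ.app α
      rw [← hv α]
      exact congrArg _ (h3 _ _ (hr _))
  · rintro ⟨χ, rfl⟩
    refine Dual.ext fun α => D.T_injective n.le_succ ?_
    rw [hVd, Dual.zero_app, map_zero]
    change D.T _ (χ.app _) = 0
    rw [res_ver, Dual.app_zero, map_zero]

/-- The ghost component of `V y` is `p` times the preceding one of `y`, and this `p` lowers the
denominator from `p^{n+1}` to `p^n`. -/
theorem verDual_Psi (e n : ℕ) (hn : 1 ≤ n) (Vd : D.Dual e (n + 1) →ₗ[A] D.Dual (e + 1) n)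
    (hVd : D.IsVerDual e n Vd) (g : Ap p A (n + 1)) :
    Vd (D.Psi e (n + 1) g) = D.Psi (e + 1) n (red p A n.le_succ g) := by
  obtain ⟨g, rfl⟩ := Ideal.Quotient.mk_surjective g
  refine Dual.ext fun α => D.T_injective n.le_succ (D.ev_ext fun x => ?_)
  obtain ⟨y, hy⟩ := proj_surjective n (α * (D.F n ^ (e + 1)) (res n.le_succ x))
  have h1 : proj p A (n + 1) (WittVector.verschiebung y) = ver n α * (D.F (n + 1) ^ e) x := by
    rw [ver_mul D, res_F_pow, ← F_pow_succ_apply, ← hy, ver_proj]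
  have h2 : red p A n.le_succ (Ideal.Quotient.mk _ g) = Ideal.Quotient.mk _ g := rfl
  obtain ⟨m, rfl⟩ := Nat.exists_eq_add_of_le' hn
  rw [hVd, ev_T, h2, D.ev_Psi_mk (e + 1) (m + 1) m.succ_pos _ _ _ y hy,
    D.ev_Psi_mk e (m + 1 + 1) (Nat.succ_pos _) _ _ _ _ h1]
  have h3 := frac_pow_mul (p := p) 1 (m + 1)
    (D.trA^[e + (m + 1 + 1) - 1] (g * WittVector.ghostComponent m y))
  rw [← trA_iterate_pow_mul, pow_one, mul_left_comm, Nat.add_comm 1 (m + 1)] at h3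
  rw [Nat.add_sub_cancel (m + 1) 1, WittVector.ghostComponent_verschiebung]
  refine h3.trans ?_
  rw [Nat.add_sub_cancel, show e + (m + 1 + 1) - 1 = e + 1 + (m + 1) - 1 by omega]

/-! ### Surjectivity -/

/-- For `n = 1` the values `ψ(b)(1)`, with `b ∈ A` mapped onto `W_1(A/p)`, are `p`-torsion in
`A[1/p]/A`, thus lie in `A/p`. They form a `φ^{-e}`-linear map, which duality mod `p` represents by
some `g`. -/
theorem Psi_one_surjective
    (H : ∀ h : A →+ Ap p A 1, (∀ a b, h (D.φ a * b) = a • h b) →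
      ∃ g, ∀ b, h b = Ideal.Quotient.mk _ (D.trA (b * g)))
    (e : ℕ) : Function.Surjective (D.Psi e 1) := by
  intro ψ
  have hs : Function.Surjective (D.sW 1) := fun x => by
    obtain ⟨y, rfl⟩ := proj_surjective 1 x
    refine ⟨y.coeff 0, TruncatedWittVector.ext fun i => ?_⟩
    obtain rfl := Subsingleton.elim i 0
    change (proj p A 1 (D.s (y.coeff 0))).coeff 0 = _
    rw [coeff_proj, coeff_proj]
    congr 1
    have := D.ghost_s (y.coeff 0) 0
    rw [ghost_eq] at this
    simpa using this
  have h1 (b : A) : ∃ c, frac p A 1 c = D.ev (ψ.app (D.sW 1 b)) 1 := by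
    obtain ⟨c, hc⟩ := exists_frac_eq (p := p) 1 (D.ev (ψ.app (D.sW 1 b)) 1) (by
      rw [← ev_sW_mul, map_pow, map_natCast, D.pow_mul_W, map_zero])
    exact ⟨_, hc⟩
  choose h hh using h1
  have hinj := frac_injective D.pow_torsionFree 1
  obtain ⟨g, hg⟩ := D.exists_trA_iterate_eq H e
    (AddMonoidHom.mk' h fun a b => hinj (by
      rw [map_add, hh, hh, hh, map_add, Dual.app_add, ev_add]))
    (fun a b => hinj (by
      change frac p A 1 (h _) = frac p A 1 (a • h b)
      rw [map_smul, hh, hh, map_mul, ← F_pow_sW, Dual.app_smul, ev_smul, ev_sW_mul]))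
  refine ⟨Ideal.Quotient.mk _ g, Dual.ev_ext fun α x => ?_⟩
  rw [Dual.ev_app, Dual.ev_app ψ]
  obtain ⟨b, hb⟩ := hs ((D.F 1 ^ e) x * α)
  rw [← hb, ← hh, D.ev_Psi_mk e 1 le_rfl _ _ _ (D.s b) (by rw [map_one, mul_one]; rfl), ghost_s]
  refine congrArg _ (Eq.trans ?_ (hg b).symm)
  rw [Nat.add_sub_cancel, mul_comm]
  rfl

theorem u_one_iterate_surjective (H : ∀ a : A, ∃ b, (p : A) ^ 1 ∣ D.trA b - a) (n : ℕ) :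
    Function.Surjective (D.u 1)^[n] := by
  refine Function.Surjective.iterate (fun a => ?_) n
  obtain ⟨a, rfl⟩ := Ideal.Quotient.mk_surjective a
  obtain ⟨b, hb⟩ := H a
  exact ⟨Ideal.Quotient.mk _ b, by rw [u_mk, mk_eq_mk_iff]; exact hb⟩

theorem red_surjective {m n : ℕ} (h : m ≤ n) : Function.Surjective (red p A h) := by
  intro x
  obtain ⟨a, rfl⟩ := Ideal.Quotient.mk_surjective x
  exact ⟨Ideal.Quotient.mk _ a, rfl⟩

/-- Diagram chase: `ψ` is corrected by a preimage of `Vd ψ`; the difference comes from `W_1`, where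
`Ψ^e_1 ∘ u^n` is surjective. -/
theorem Psi_surjective
    (H : ∀ h : A →+ Ap p A 1, (∀ a b, h (D.φ a * b) = a • h b) →
      ∃ g, ∀ b, h b = Ideal.Quotient.mk _ (D.trA (b * g)))
    (H' : ∀ a : A, ∃ b, (p : A) ^ 1 ∣ D.trA b - a)
    (e n : ℕ) (hn : 1 ≤ n) : Function.Surjective (D.Psi e n) := by
  induction n, hn using Nat.le_induction generalizing e with
  | base => exact D.Psi_one_surjective H e
  | succ n hn ih =>
    intro ψ
    obtain ⟨Vd, hVd, -⟩ := D.existsUnique_verDual e n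
    obtain ⟨g, hg⟩ := ih (e + 1) (Vd ψ)
    obtain ⟨g, rfl⟩ := red_surjective n.le_succ g
    obtain ⟨χ, hχ⟩ := (D.exact_resDual_verDual e n Vd hVd (ψ - D.Psi e (n + 1) g)).1 (by
      rw [map_sub, D.verDual_Psi e n hn Vd hVd, hg, sub_self])
    obtain ⟨c, rfl⟩ := D.Psi_one_surjective H e χ
    obtain ⟨c, rfl⟩ := D.u_one_iterate_surjective H' n c
    refine ⟨mulPow p A n c + g, ?_⟩
    rw [D.Psi_add _ _ n.succ_pos, Psi_mulPow, hχ, sub_add_cancel]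

/-! ### The kernel of `Ψ` -/

theorem dvd_ghostComponent_iff (e N : ℕ) (g : A) :
    (∀ y : WittVector p A, (p : A) ^ (N + 1) ∣ D.trA^[e + N] (g * WittVector.ghostComponent N y))
      ↔ ∀ j ≤ N, (p : A) ^ (j + 1) ∣ D.trA^[j] g := by
  have hdvd {k : ℕ} {a : A} : (p : A) ^ (k + 1) ∣ (p : A) ^ 1 * a ↔ (p : A) ^ k ∣ a := by
    rw [pow_succ', pow_one]
    refine ⟨fun ⟨c, hc⟩ => ⟨c, D.pow_mul_cancel 1 ?_⟩, mul_dvd_mul_left _⟩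
    rw [pow_one, hc, mul_assoc]
  have hL (N : ℕ) (g : A) (h : ∀ y : WittVector p A,
      (p : A) ^ (N + 1) ∣ D.trA^[e + N] (g * WittVector.ghostComponent N y)) :
      (p : A) ^ 1 ∣ g := by
    refine D.pow_dvd_of_trA_iterate (e + N) fun b => ?_
    -- Testing against `V^N[b]` gives `p ∣ trA^{e+N}(bg)` for every `b`.
    have h1 : WittVector.ghostComponent N
        (WittVector.verschiebung^[N] (WittVector.teichmuller p b)) = (p : A) ^ N * b := by
      clear h
      induction N with
      | zero => simp [WittVector.ghostComponent_teichmuller]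
      | succ N ih =>
        rw [Function.iterate_succ_apply', WittVector.ghostComponent_verschiebung, ih, pow_succ',
          mul_assoc]
    obtain ⟨c, hc⟩ := h (WittVector.verschiebung^[N] (WittVector.teichmuller p b))
    rw [h1, mul_left_comm, trA_iterate_pow_mul, pow_succ, mul_assoc] at hc
    refine ⟨c, ?_⟩
    rw [pow_one, mul_comm b]
    exact D.pow_mul_cancel N hc
  induction N generalizing g with
  | zero =>
    refine ⟨fun h j hj => ?_, fun h y => ?_⟩
    · obtain rfl := Nat.le_zero.1 hj
      exact hL 0 g h
    · exact D.pow_dvd_trA_iterate _ (Dvd.dvd.mul_right (h 0 le_rfl) _)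
  | succ N ih =>
    by_cases hg : (p : A) ^ 1 ∣ g
    · obtain ⟨g, rfl⟩ := hg
      trans ∀ j ≤ N, (p : A) ^ (j + 1) ∣ D.trA^[j] (D.trA g)
      -- After division by `p`, `w_{N+1}` may be replaced by `φ(w_N)` modulo `p^{N+1}`, and one
      -- trace turns the argument into `w_N · trA(g)`.
      · refine Iff.trans (forall_congr' fun y => ?_) (ih (D.trA g))
        rw [mul_assoc, trA_iterate_pow_mul, hdvd, ← dvd_iff_dvd_of_dvd_sub
          (D.pow_dvd_trA_iterate_sub (e + (N + 1)) (a := g * D.φ (WittVector.ghostComponent N y))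
            (b := g * WittVector.ghostComponent (N + 1) y) ?_), ← add_assoc,
          Function.iterate_succ_apply, mul_comm g, trA_mul, mul_comm]
        rw [← mul_sub, ← neg_sub, mul_neg, dvd_neg]
        exact Dvd.dvd.mul_left (D.dvd_ghostComponent_succ_sub N y) _
      · refine ⟨fun h j hj => ?_, fun h j hj => ?_⟩
        · rw [trA_iterate_pow_mul, hdvd]
          rcases j with _ | j
          · simp
          · exact h j (Nat.succ_le_succ_iff.1 hj)
        · have := h (j + 1) (Nat.succ_le_succ hj)
          rwa [trA_iterate_pow_mul, hdvd] at this
    · exact ⟨fun h => absurd (hL _ g h) hg, fun h => absurd (h 0 (Nat.zero_le _)) hg⟩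

theorem Psi_eq_zero_iff (e n : ℕ) (hn : 1 ≤ n) (g : Ap p A n) :
    D.Psi e n g = 0 ↔ ∀ r : ℕ, 1 ≤ r → r ≤ n →
      (D.u n)^[r - 1] g ∈ Ideal.span {(p : Ap p A n) ^ r} := by
  obtain ⟨g, rfl⟩ := Ideal.Quotient.mk_surjective g
  obtain ⟨N, rfl⟩ := Nat.exists_eq_add_of_le' hn
  have hinj := frac_injective D.pow_torsionFree (N + 1)
  have h1 : D.Psi e (N + 1) (Ideal.Quotient.mk _ g) = 0 ↔ ∀ y : WittVector p A,
      (p : A) ^ (N + 1) ∣ D.trA^[e + N] (g * WittVector.ghostComponent N y) := by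
    constructor
    · intro h y
      -- Taking `x = 1` and `α` the image of `y` makes every `y ∈ W(A)` occur.
      have h2 := D.ev_Psi_mk e (N + 1) hn g (proj p A (N + 1) y) 1 y (by rw [map_one, mul_one])
      rw [h] at h2
      have h3 := hinj (h2.symm.trans ((D.ev_zero 1).trans (map_zero _).symm))
      exact Ideal.mem_span_singleton.1 (Ideal.Quotient.eq_zero_iff_mem.1 h3)
    · intro h
      refine Dual.ev_ext fun α x => ?_
      obtain ⟨y, hy⟩ := proj_surjective (N + 1) (α * (D.F (N + 1) ^ e) x)
      refine (D.ev_Psi_mk e (N + 1) hn g α x y hy).trans ?_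
      change frac p A (N + 1) (Ideal.Quotient.mk _
        (D.trA^[e + N] (g * WittVector.ghostComponent N y))) = _
      rw [Ideal.Quotient.eq_zero_iff_mem.2
        (Ideal.mem_span_singleton.2 (h y)), map_zero]
      exact (D.ev_zero x).symm
  have h2 (r : ℕ) (hr : r ≤ N + 1) (a : A) :
      (Ideal.Quotient.mk _ a : Ap p A (N + 1)) ∈ Ideal.span {(p : Ap p A (N + 1)) ^ r}
        ↔ (p : A) ^ r ∣ a := by
    rw [Ideal.mem_span_singleton,
      ← map_natCast (Ideal.Quotient.mk (Ideal.span {(p : A) ^ (N + 1)})), ← map_pow]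
    constructor
    · rintro ⟨c, hc⟩
      obtain ⟨c, rfl⟩ := Ideal.Quotient.mk_surjective c
      rw [← map_mul, mk_eq_mk_iff] at hc
      exact (dvd_iff_dvd_of_dvd_sub ((pow_dvd_pow _ hr).trans hc)).2 (dvd_mul_right _ _)
    · exact map_dvd _
  rw [h1, dvd_ghostComponent_iff]
  constructor
  · intro h r hr hr'
    obtain ⟨j, rfl⟩ := Nat.exists_eq_add_of_le' hr
    rw [u_iterate_mk, h2 _ hr', Nat.add_sub_cancel]
    exact h j (Nat.succ_le_succ_iff.1 hr')
  · intro h j hj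
    have := h (j + 1) (Nat.succ_pos _) (Nat.succ_le_succ hj)
    rwa [u_iterate_mk, h2 _ (Nat.succ_le_succ hj), Nat.add_sub_cancel] at this

/-! ### The upper row -/

theorem mulPow_injective (D : DualizingData p A) (n : ℕ) : Function.Injective (mulPow p A n) := by
  rw [injective_iff_map_eq_zero]
  intro x hx
  obtain ⟨a, rfl⟩ := Ideal.Quotient.mk_surjective x
  have h1 : (Ideal.Quotient.mk _ ((p : A) ^ n * a) : Ap p A (n + 1)) = 0 := hx
  obtain ⟨c, hc⟩ := Ideal.mem_span_singleton.1 (Ideal.Quotient.eq_zero_iff_mem.1 h1)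
  rw [pow_succ, mul_assoc] at hc
  refine Ideal.Quotient.eq_zero_iff_mem.2 (Ideal.mem_span_singleton.2 ⟨c, ?_⟩)
  rw [pow_one]
  exact D.pow_mul_cancel n hc

theorem exact_mulPow_red (n : ℕ) : Function.Exact (mulPow p A n) (red p A n.le_succ) := by
  intro x
  constructor
  · obtain ⟨a, rfl⟩ := Ideal.Quotient.mk_surjective x
    intro h
    have h1 : (Ideal.Quotient.mk _ a : Ap p A n) = 0 := h
    obtain ⟨c, rfl⟩ := Ideal.mem_span_singleton.1 (Ideal.Quotient.eq_zero_iff_mem.1 h1)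
    exact ⟨Ideal.Quotient.mk _ c, rfl⟩
  · rintro ⟨y, rfl⟩
    obtain ⟨a, rfl⟩ := Ideal.Quotient.mk_surjective y
    change (Ideal.Quotient.mk _ ((p : A) ^ n * a) : Ap p A n) = 0
    exact Ideal.Quotient.eq_zero_iff_mem.2 (Ideal.mem_span_singleton.2 (dvd_mul_right _ _))

end DualizingData

end WittDual

theorem mainTheorem5 (p : ℕ) [Fact p.Prime] (A : Type u) [CommRing A] [IsRegularLocalRing A]
    (D : WittDual.DualizingData p A) :
    -- `Ψ^e_n` is an `A`-module homomorphism on `φ^{e+n-1}_* A/p^n`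
    (∀ e n : ℕ, 1 ≤ e → 1 ≤ n →
      (∀ g g' : WittDual.Ap p A n, D.Psi e n (g + g') = D.Psi e n g + D.Psi e n g') ∧
      (∀ (a : A) (g : WittDual.Ap p A n),
        D.Psi e n ((D.φ ^ (e + n - 1)) a • g) = a • D.Psi e n g)) ∧
    -- (1)
    (∀ e n : ℕ, 1 ≤ e → 1 ≤ n → ∀ g : WittDual.Ap p A (n + 1),
      D.Psi e (n + 1) (p * g)
        = D.resDual e n.le_succ (D.Psi e n (WittDual.red p A n.le_succ (D.u (n + 1) g)))) ∧
    -- (2): both rows are exact and both squares commute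
    (∀ e n : ℕ, 1 ≤ e → ∀ _hn : 1 ≤ n,
      Function.Injective (WittDual.mulPow p A n) ∧
      Function.Exact (WittDual.mulPow p A n) (WittDual.red p A n.le_succ) ∧
      Function.Surjective (WittDual.red p A n.le_succ) ∧
      Function.Injective (D.resDual e (Nat.succ_le_succ n.zero_le)) ∧
      (∀ a : WittDual.Ap p A 1,
        D.Psi e (n + 1) (WittDual.mulPow p A n a)
          = D.resDual e (Nat.succ_le_succ n.zero_le) (D.Psi e 1 ((D.u 1)^[n] a))) ∧
      (∃! Vd : D.Dual e (n + 1) →ₗ[A] D.Dual (e + 1) n, D.IsVerDual e n Vd) ∧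
      (∀ Vd : D.Dual e (n + 1) →ₗ[A] D.Dual (e + 1) n, D.IsVerDual e n Vd →
        Function.Exact (D.resDual e (Nat.succ_le_succ n.zero_le)) Vd ∧
        Function.Surjective Vd ∧
        ∀ g : WittDual.Ap p A (n + 1),
          Vd (D.Psi e (n + 1) g) = D.Psi (e + 1) n (WittDual.red p A n.le_succ g))) ∧
    -- surjectivity
    (∀ e n : ℕ, 1 ≤ e → 1 ≤ n → Function.Surjective (D.Psi e n)) ∧
    -- (3)
    (∀ e n : ℕ, 1 ≤ e → 1 ≤ n → ∀ g : WittDual.Ap p A n,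
      D.Psi e n g = 0 ↔
        ∀ r : ℕ, 1 ≤ r → r ≤ n →
          (D.u n)^[r - 1] g ∈ Ideal.span {(p : WittDual.Ap p A n) ^ r}) ∧
    -- (4)
    (∀ e n : ℕ, 1 ≤ e → ∀ hn : 1 ≤ n, ∀ f g : WittDual.Ap p A n,
      D.Psi e n (g * f ^ p ^ (e + n - 1))
        = WittDual.teich n (WittDual.redP p A hn f) • D.Psi e n g) := by
  have H := D.exists_trA_eq
  have H' := D.exists_dvd_trA_sub
  refine ⟨fun e n _ hn => ⟨D.Psi_add e n hn, D.Psi_smul e n hn⟩,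
    fun e n _ hn g => D.Psi_p_mul e n hn g, fun e n _ hn => ?_,
    fun e n _ hn => D.Psi_surjective H H' e n hn, fun e n _ hn g => D.Psi_eq_zero_iff e n hn g,
    fun e n _ hn f g => D.Psi_mul_pow e n hn f g⟩
  refine ⟨D.mulPow_injective n, WittDual.DualizingData.exact_mulPow_red n,
    WittDual.DualizingData.red_surjective n.le_succ, D.resDual_injective e _, D.Psi_mulPow e n,
    D.existsUnique_verDual e n, fun Vd hVd => ⟨D.exact_resDual_verDual e n Vd hVd, fun ψ => ?_,
      D.verDual_Psi e n hn Vd hVd⟩⟩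
  -- `Vd` is surjective because `Vd ∘ Ψ^e_{n+1}` equals `Ψ^{e+1}_n` after reduction, a composite of
  -- surjections.
  obtain ⟨g, rfl⟩ := D.Psi_surjective H H' (e + 1) n hn ψ
  obtain ⟨g, rfl⟩ := WittDual.DualizingData.red_surjective n.le_succ g
  exact ⟨_, D.verDual_Psi e n hn Vd hVd g⟩
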